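/- Let $s>1$, let $U\subset\mathbb R$ be an open neighbourhood of $0$, and let $c:U\to\mathbb R$ belong to the Gevrey class $G^s(U)$, i.e. $c$ is smooth and there are $K,A>0$ with $|c^{(m)}(\theta)|\le K A^m (m!)^s$ for all $\theta\in U$ and all $m\in\mathbb N$ (including $m=0$). Suppose $c(0)=1$ and $c^{(m)}(0)=0$ for all $m\ge 1$. Let $\varphi\in C_b^2(\mathbb R)$ and $\psi\in C_b^1(\mathbb R)$, where $C_b^m(\mathbb R)$ is the set of $C^m$ functions that are bounded together with their derivatives up to order $m$. For $\varepsilon>0$ consider the Cauchy problem $$u_{tt}-c(u_x)^2u_{xx}=0,\qquad u(0,x)=\varepsilon\varphi(x),\quad u_t(0,x)=\varepsilon\psi(x)\qquad(x\in\mathbb R),$$ and let its lifespan $T^*=T^*(\varepsilon)\in[0,\infty]$ be the supremum of all real $T>0$ for which there is a classical ($C^2$) solution $u$ on $[0,T)\times\mathbb R$, with $u_x$ taking values in $U$ and $c(u_x)\neq 0$, such that $$\sup_{t\in[0,T)}\Bigl(\|u(t)\|_{L^\infty}+\|u_t(t)\|_{L^\infty}+\|u_x(t)\|_{L^\infty}+\|u_{tt}(t)\|_{L^\infty}+\|u_{tx}(t)\|_{L^\infty}+\|u_{xx}(t)\|_{L^\infty}+\|c(u_x(t))^{-1}\|_{L^\infty}\Bigr)<\infty$$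 ($\sup\emptyset=0$). (a) There are constants $\varepsilon_0,C_1,C_2>0$ such that for all $0<\varepsilon\le\varepsilon_0$, $$C_1\exp\bigl(C_2\,\varepsilon^{-1/(s-1)}\bigr)\le T^*(\varepsilon).$$ (b) Suppose moreover that there are constants $C,C'>0$ with $C\exp\bigl(-C'|\theta|^{-1/(s-1)}\bigr)\le c'(\theta)$ for all $\theta\ne 0$ in some neighbourhood of $0$, that $\varphi_x(x)\to0$ and $\psi(x)\to 0$ as $|x|\to\infty$, and that there is a point $x_0\in\mathbb R$ with $\psi_x(x_0)+\varphi_{xx}(x_0)>0$ or $\psi_x(x_0)-\varphi_{xx}(x_0)>0$. Then there are constants $\varepsilon_0,C_3,C_4>0$ such that for all $0<\varepsilon\le\varepsilon_0$, $$T^*(\varepsilon)\le C_3\exp\bigl(C_4\,\varepsilon^{-1/(s-1)}\bigr).$$ The constants do not depend on $\varepsilon$. -/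

import Mathlib

open Set Filter Topology
open scoped ContDiff

/-- `f ∈ C_b^m(ℝ)`: `f` is `m` times continuously differentiable and `f` and all its derivatives
up to order `m` are bounded on `ℝ`. -/
def MemCb (m : ℕ) (f : ℝ → ℝ) : Prop :=
  ContDiff ℝ m f ∧ ∀ k ≤ m, ∃ M : ℝ, ∀ x, |iteratedDeriv k f x| ≤ M

/-- The Gevrey class `G^s(Ω)` (for `Ω` open): smooth functions on `Ω` with
`|f^{(m)}(θ)| ≤ C A^m (m!)^s` for all `θ ∈ Ω` and all `m`, with `C`, `A` independent of `m`, `θ`. -/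
def MemGevrey (s : ℝ) (Ω : Set ℝ) (f : ℝ → ℝ) : Prop :=
  ContDiffOn ℝ ∞ f Ω ∧
    ∃ C > 0, ∃ A > 0, ∀ m : ℕ, ∀ θ ∈ Ω,
      |iteratedDeriv m f θ| ≤ C * A ^ m * (m.factorial : ℝ) ^ s

/-- `u` is a classical (`C²`) solution on `[0,T) × ℝ` of `u_tt - c(u_x)² u_xx = 0`,
`u(0,·) = f`, `u_t(0,·) = g`, with partial derivatives
`ut = ∂_t u`, `ux = ∂_x u`, `utt = ∂_t² u`, `utx = ∂_x ∂_t u = ∂_t ∂_x u`, `uxx = ∂_x² u`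
(one-sided in time at `t = 0`), all continuous on `[0,T) × ℝ`.
The wave speed `c` is only meaningful on `U`, so `u_x` is required to take its values there. -/
structure IsClassicalSolution (c : ℝ → ℝ) (U : Set ℝ) (f g : ℝ → ℝ) (T : ℝ)
    (u ut ux utt utx uxx : ℝ → ℝ → ℝ) : Prop where
  cont_u : ContinuousOn (fun p : ℝ × ℝ => u p.1 p.2) (Ico 0 T ×ˢ univ)
  cont_ut : ContinuousOn (fun p : ℝ × ℝ => ut p.1 p.2) (Ico 0 T ×ˢ univ)
  cont_ux : ContinuousOn (fun p : ℝ × ℝ => ux p.1 p.2) (Ico 0 T ×ˢ univ)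
  cont_utt : ContinuousOn (fun p : ℝ × ℝ => utt p.1 p.2) (Ico 0 T ×ˢ univ)
  cont_utx : ContinuousOn (fun p : ℝ × ℝ => utx p.1 p.2) (Ico 0 T ×ˢ univ)
  cont_uxx : ContinuousOn (fun p : ℝ × ℝ => uxx p.1 p.2) (Ico 0 T ×ˢ univ)
  deriv_t : ∀ t ∈ Ico 0 T, ∀ x, HasDerivWithinAt (fun τ => u τ x) (ut t x) (Ico 0 T) t
  deriv_x : ∀ t ∈ Ico 0 T, ∀ x, HasDerivAt (fun y => u t y) (ux t x) x
  deriv_tt : ∀ t ∈ Ico 0 T, ∀ x, HasDerivWithinAt (fun τ => ut τ x) (utt t x) (Ico 0 T) t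
  deriv_tx : ∀ t ∈ Ico 0 T, ∀ x, HasDerivAt (fun y => ut t y) (utx t x) x
  deriv_xt : ∀ t ∈ Ico 0 T, ∀ x, HasDerivWithinAt (fun τ => ux τ x) (utx t x) (Ico 0 T) t
  deriv_xx : ∀ t ∈ Ico 0 T, ∀ x, HasDerivAt (fun y => ux t y) (uxx t x) x
  mem_domain : ∀ t ∈ Ico 0 T, ∀ x, ux t x ∈ U
  equation : ∀ t ∈ Ico 0 T, ∀ x, utt t x - c (ux t x) ^ 2 * uxx t x = 0
  initial_u : ∀ x, u 0 x = f x
  initial_ut : ∀ x, ut 0 x = g x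

/-- The Cauchy problem has a classical solution on `[0,T) × ℝ` for which
`‖u‖ + ‖u_t‖ + ‖u_x‖ + ‖u_tt‖ + ‖u_tx‖ + ‖u_xx‖ + ‖c(u_x)⁻¹‖` (sup norms in `x`) is bounded
for `t ∈ [0,T)`. -/
def HasBoundedSolution (c : ℝ → ℝ) (U : Set ℝ) (f g : ℝ → ℝ) (T : ℝ) : Prop :=
  ∃ u ut ux utt utx uxx : ℝ → ℝ → ℝ,
    IsClassicalSolution c U f g T u ut ux utt utx uxx ∧
    ∃ M : ℝ, ∀ t ∈ Ico 0 T, ∀ x,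
      |u t x| ≤ M ∧ |ut t x| ≤ M ∧ |ux t x| ≤ M ∧
      |utt t x| ≤ M ∧ |utx t x| ≤ M ∧ |uxx t x| ≤ M ∧
      c (ux t x) ≠ 0 ∧ |(c (ux t x))⁻¹| ≤ M

/-- The lifespan `T* ∈ [0,∞]` of the Cauchy problem with data `u(0,·) = f`, `u_t(0,·) = g`
(`sSup ∅ = 0` if there is no solution at all). -/
noncomputable def lifespan (c : ℝ → ℝ) (U : Set ℝ) (f g : ℝ → ℝ) : ENNReal :=
  sSup {τ : ENNReal | ∃ T : ℝ, 0 < T ∧ HasBoundedSolution c U f g T ∧ τ = ENNReal.ofReal T}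

/-!
Let `F` be a primitive of `c`. The Riemann invariants `u_t ± F(u_x)` are constant along the
characteristics `dx/dt = ∓c(u_x)`, so `u_t` and `u_x` stay of size `ε` as long as the solution
exists. A Gevrey function that is flat at `0` satisfies `|c'(θ)| ≤ C exp(-κ |θ|^(-1/(s-1)))`, so the
characteristics of the solution bend very little.

*Lower bound.* As functions of the characteristic coordinates `(a, b)` the invariants are the
initial data, and only the time `t(a, b)` is unknown. It solves a linear Goursat problem whose
coefficients have the size of the derivatives of the speed, `ε exp(-κ ε^(-1/(s-1)))`; hence `t_a`
and `t_b` keep their signs, and `(a, b) ↦ (t, x)` is invertible, up to times comparable to the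
inverse of that size.

*Upper bound.* The derivative of one invariant, multiplied by `√c`, satisfies a Riccati equation
along its characteristic, with coefficient `c'(u_x)` up to bounded factors. By the decay of the data
the other invariant is eventually negligible along that characteristic, so `|u_x|` is bounded below
by a multiple of `ε` there and `c'(u_x)` by an exponential. The Riccati equation then blows up
within the inverse of this coefficient times the initial value.
-/

open scoped NNReal BoundedContinuousFunction

/-! ### Calculus in the plane -/

/-- The linear form `p da + q db` on the plane with coordinates `(a, b)`. -/
noncomputable def linForm (p q : ℝ) : ℝ × ℝ →L[ℝ] ℝ :=
  p • ContinuousLinearMap.fst ℝ ℝ ℝ + q • ContinuousLinearMap.snd ℝ ℝ ℝ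

@[simp]
theorem linForm_apply (p q : ℝ) (v : ℝ × ℝ) : linForm p q v = p * v.1 + q * v.2 := rfl

theorem norm_linForm_le (p q : ℝ) : ‖linForm p q‖ ≤ |p| + |q| := by
  refine ContinuousLinearMap.opNorm_le_bound _ (by positivity) fun v => ?_
  calc ‖linForm p q v‖ ≤ |p * v.1| + |q * v.2| := abs_add_le _ _
    _ = |p| * ‖v.1‖ + |q| * ‖v.2‖ := by rw [abs_mul, abs_mul]; rfl
    _ ≤ |p| * ‖v‖ + |q| * ‖v‖ := by
      gcongr
      exacts [norm_fst_le v, norm_snd_le v]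
    _ = (|p| + |q|) * ‖v‖ := by ring

theorem hasStrictFDerivAt_of_partials {f fa fb : ℝ × ℝ → ℝ} {s : Set (ℝ × ℝ)} (hs : IsOpen s)
    (hfa : ContinuousOn fa s) (hfb : ContinuousOn fb s)
    (ha : ∀ z ∈ s, HasDerivAt (fun a => f (a, z.2)) (fa z) z.1)
    (hb : ∀ z ∈ s, HasDerivAt (fun b => f (z.1, b)) (fb z) z.2) {z : ℝ × ℝ} (hz : z ∈ s) :
    HasStrictFDerivAt f (linForm (fa z) (fb z)) z := by
  have continuousAt_span {g : ℝ × ℝ → ℝ} (hg : ContinuousOn g s) :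
      ContinuousAt (fun w => ContinuousLinearMap.toSpanSingleton ℝ (g w)) z :=
    (ContinuousLinearMap.toSpanSingletonCLE (𝕜 := ℝ) (E := ℝ)).continuous.continuousAt.comp
      (hg.continuousAt (hs.mem_nhds hz))
  refine (hasStrictFDerivAt_uncurry_coprod (𝕜 := ℝ) (u := z) (f := fun a b => f (a, b))
    (f₁ := fun a b => ContinuousLinearMap.toSpanSingleton ℝ (fa (a, b)))
    (f₂ := fun a b => ContinuousLinearMap.toSpanSingleton ℝ (fb (a, b)))
    ?_ ?_ (continuousAt_span hfa) (continuousAt_span hfb)).congr_fderiv ?_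
  · filter_upwards [hs.mem_nhds hz] with w hw using (ha w hw).hasFDerivAt
  · filter_upwards [hs.mem_nhds hz] with w hw using (hb w hw).hasFDerivAt
  · ext <;> simp [Function.HasUncurry.uncurry]

theorem hasFDerivAt_planar_inverse {G g : ℝ × ℝ → ℝ × ℝ} {w : ℝ × ℝ} {A B C D δ : ℝ}
    (hδ : δ ≠ 0) (hdet : A * D - B * C = δ) (hg : ContinuousAt g w)
    (hG : HasFDerivAt G ((linForm A B).prod (linForm C D)) (g w))
    (hGg : ∀ᶠ y in 𝓝 w, G (g y) = y) :
    HasFDerivAt g ((linForm (D / δ) (-B / δ)).prod (linForm (-C / δ) (A / δ))) w := by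
  let e : (ℝ × ℝ) ≃L[ℝ] (ℝ × ℝ) := ContinuousLinearEquiv.equivOfInverse
    ((linForm A B).prod (linForm C D))
    ((linForm (D / δ) (-B / δ)).prod (linForm (-C / δ) (A / δ)))
    (fun z => by
      ext <;> simp only [ContinuousLinearMap.prod_apply, linForm_apply] <;> field_simp
      · linear_combination z.1 * hdet
      · linear_combination z.2 * hdet)
    (fun z => by
      ext <;> simp only [ContinuousLinearMap.prod_apply, linForm_apply] <;> field_simp
      · linear_combination z.1 * hdet
      · linear_combination z.2 * hdet)
  exact HasFDerivAt.of_local_left_inverse (f' := e) hg hG hGg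

theorem hasDerivAt_intervalIntegral_param {P W : ℝ × ℝ → ℝ} (hP : Continuous P)
    (hW : Continuous W) {a₀ a₁ b₀ r : ℝ} (hr : 0 < r)
    (hd : ∀ y ∈ uIcc a₀ a₁, ∀ b ∈ Metric.ball b₀ r, HasDerivAt (fun b => P (y, b)) (W (y, b)) b) :
    HasDerivAt (fun b => ∫ y in a₀..a₁, P (y, b)) (∫ y in a₀..a₁, W (y, b₀)) b₀ := by
  obtain ⟨M, hM⟩ := (isCompact_uIcc.prod (isCompact_closedBall b₀ r)).exists_bound_of_continuousOn
    (s := uIcc a₀ a₁ ×ˢ Metric.closedBall b₀ r) hW.continuousOn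
  refine (intervalIntegral.hasDerivAt_integral_of_dominated_loc_of_deriv_le
    (F := fun b y => P (y, b)) (F' := fun b y => W (y, b)) (bound := fun _ => M)
    (Metric.ball_mem_nhds b₀ hr) ?_ ?_ ?_ ?_ intervalIntegrable_const ?_).2
  · exact .of_forall fun b => (by fun_prop : Continuous fun y => P (y, b)).aestronglyMeasurable
  · exact (by fun_prop : Continuous fun y => P (y, b₀)).intervalIntegrable _ _
  · exact (by fun_prop : Continuous fun y => W (y, b₀)).aestronglyMeasurable
  · exact .of_forall fun y hy b hb =>
      hM (y, b) ⟨uIoc_subset_uIcc hy, Metric.ball_subset_closedBall hb⟩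
  · exact .of_forall fun y hy b hb => hd y (uIoc_subset_uIcc hy) b hb

theorem hasDerivAt_intervalIntegral_diag {P : ℝ × ℝ → ℝ} (hP : Continuous P) (b : ℝ) :
    HasDerivAt (fun b' => ∫ y in b..b', P (y, b')) (P (b, b)) b := by
  rw [hasDerivAt_iff_isLittleO, Asymptotics.isLittleO_iff]
  intro e he
  obtain ⟨d, hd, hPd⟩ := Metric.continuousAt_iff.1 (hP.continuousAt (x := (b, b))) e he
  filter_upwards [Metric.ball_mem_nhds b hd] with b' hb'
  have hc : Continuous fun y => P (y, b') := by fun_prop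
  have integral_sub_const : (∫ y in b..b', P (y, b')) - (∫ y in b..b, P (y, b))
      - (b' - b) • P (b, b) = ∫ y in b..b', (P (y, b') - P (b, b)) := by
    rw [intervalIntegral.integral_sub (hc.intervalIntegrable _ _) intervalIntegrable_const]
    simp
  rw [integral_sub_const]
  refine intervalIntegral.norm_integral_le_of_norm_le_const fun y hy => ?_
  have hy' : dist y b < d :=
    lt_of_le_of_lt (abs_sub_left_of_mem_uIcc (uIoc_subset_uIcc hy)) (Metric.mem_ball.1 hb')
  exact (hPd (x := (y, b')) (max_lt hy' (Metric.mem_ball.1 hb'))).le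

/-- The open diagonal strip `|a - b| < L`, on which the characteristic coordinates live: the
diagonal is the initial line and `a - b` is comparable to time. -/
def diagStrip (L : ℝ) : Set (ℝ × ℝ) := {z | |z.1 - z.2| < L}

theorem mem_diagStrip {L : ℝ} {z : ℝ × ℝ} : z ∈ diagStrip L ↔ |z.1 - z.2| < L := Iff.rfl

theorem diag_mem_diagStrip {L : ℝ} (hL : 0 < L) (a : ℝ) : (a, a) ∈ diagStrip L := by
  simpa [mem_diagStrip] using hL

theorem swap_mem_diagStrip {L : ℝ} {z : ℝ × ℝ} (hz : z ∈ diagStrip L) : z.swap ∈ diagStrip L := by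
  rwa [mem_diagStrip, Prod.fst_swap, Prod.snd_swap, abs_sub_comm]

theorem isOpen_diagStrip (L : ℝ) : IsOpen (diagStrip L) :=
  isOpen_lt (by fun_prop) continuous_const

theorem convex_diagStrip (L : ℝ) : Convex ℝ (diagStrip L) := by
  have : diagStrip L = (fun z : ℝ × ℝ => z.1 - z.2) ⁻¹' Metric.ball 0 L := by
    ext z; simp [diagStrip]
  rw [this]
  exact (convex_ball (0 : ℝ) L).is_linear_preimage
    (IsLinearMap.mk (fun x y => by simp; ring) (fun c x => by simp; ring))

section Potential

variable {P Q W : ℝ × ℝ → ℝ} {L : ℝ}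

theorem hasDerivAt_intervalIntegral_diagStrip (hP : Continuous P) (hW : Continuous W)
    (hPW : ∀ z ∈ diagStrip L, HasDerivAt (fun b => P (z.1, b)) (W z) z.2)
    {a b : ℝ} (hab : (a, b) ∈ diagStrip L) :
    HasDerivAt (fun b' => ∫ y in b'..a, P (y, b')) ((∫ y in b..a, W (y, b)) - P (b, b)) b := by
  have split : (fun b' => ∫ y in b'..a, P (y, b')) =
      fun b' => (∫ y in b..a, P (y, b')) - ∫ y in b..b', P (y, b') := by
    funext b'
    have hc : Continuous fun y => P (y, b') := by fun_prop
    rw [intervalIntegral.integral_interval_sub_left (hc.intervalIntegrable _ _)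
      (hc.intervalIntegrable _ _)]
  rw [split]
  refine (hasDerivAt_intervalIntegral_param hP hW (sub_pos.2 hab) fun y hy b' hb' => ?_).sub
    (hasDerivAt_intervalIntegral_diag hP b)
  refine hPW (y, b') ?_
  rw [Metric.mem_ball, Real.dist_eq] at hb'
  calc |y - b'| = |(y - b) - (b' - b)| := by ring_nf
    _ ≤ |y - b| + |b' - b| := abs_sub _ _
    _ < |a - b| + (L - |a - b|) := add_lt_add_of_le_of_lt (abs_sub_left_of_mem_uIcc hy) hb'
    _ = L := by ring

/-- `P da + Q db` is only known to have mixed derivatives, so it need not be differentiable and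
the Poincaré lemma does not apply directly. -/
theorem exists_potential_diagStrip (hP : Continuous P) (hQ : Continuous Q) (hW : Continuous W)
    (hPW : ∀ z ∈ diagStrip L, HasDerivAt (fun b => P (z.1, b)) (W z) z.2)
    (hQW : ∀ z ∈ diagStrip L, HasDerivAt (fun a => Q (a, z.2)) (W z) z.1)
    {D : ℝ → ℝ} (hD : ∀ a, HasDerivAt D (P (a, a) + Q (a, a)) a) :
    ∃ f : ℝ × ℝ → ℝ, (∀ a, f (a, a) = D a) ∧
      ∀ z ∈ diagStrip L, HasFDerivAt f (linForm (P z) (Q z)) z := by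
  refine ⟨fun z => D z.2 + ∫ y in z.2..z.1, P (y, z.2), by simp, fun z hz =>
    (hasStrictFDerivAt_of_partials (isOpen_diagStrip L) hP.continuousOn hQ.continuousOn
      ?_ ?_ hz).hasFDerivAt⟩
  · rintro ⟨a, b⟩ -
    have hc : Continuous fun y => P (y, b) := by fun_prop
    exact (hc.integral_hasStrictDerivAt b a).hasDerivAt.const_add (D b)
  · rintro ⟨a, b⟩ hab
    have integral_W : ∫ y in b..a, W (y, b) = Q (a, b) - Q (b, b) :=
      intervalIntegral.integral_eq_sub_of_hasDerivAt (f := fun y => Q (y, b))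
        (fun y hy => hQW (y, b) (lt_of_le_of_lt (abs_sub_left_of_mem_uIcc hy) hab))
        ((by fun_prop : Continuous fun y => W (y, b)).intervalIntegrable _ _)
    refine ((hD b).add (hasDerivAt_intervalIntegral_diagStrip hP hW hPW hab)).congr_deriv ?_
    rw [integral_W]
    ring

end Potential

/-! ### The linear Goursat problem -/

/-- The truncation of `r` to `[-L, L]`. -/
def truncate (L r : ℝ) : ℝ := max (-L) (min L r)

theorem continuous_truncate (L : ℝ) : Continuous (truncate L) := by unfold truncate; fun_prop

theorem abs_truncate_le {L : ℝ} (hL : 0 ≤ L) (r : ℝ) : |truncate L r| ≤ L :=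
  abs_le.2 ⟨le_max_left _ _, max_le (by linarith) (min_le_left _ _)⟩

theorem truncate_of_abs_le {L r : ℝ} (h : |r| ≤ L) : truncate L r = r := by
  rw [truncate, min_eq_right (abs_le.1 h).2, max_eq_right (abs_le.1 h).1]

/-- The primitive of `W` in the second variable with values `p` on the diagonal. The length of
integration is truncated at `L`, so that bounded functions have bounded primitives; inside
`diagStrip L` this has no effect. -/
noncomputable def diagPrimitive (L : ℝ) (p : ℝ → ℝ) (W : ℝ × ℝ → ℝ) (z : ℝ × ℝ) : ℝ :=
  p z.1 + ∫ r in (0 : ℝ)..truncate L (z.2 - z.1), W (z.1, z.1 + r)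

section DiagPrimitive

variable {L : ℝ} {p : ℝ → ℝ} {W W' : ℝ × ℝ → ℝ}

theorem continuous_diagPrimitive (hp : Continuous p) (hW : Continuous W) :
    Continuous (diagPrimitive L p W) := by
  refine Continuous.add (by fun_prop)
    (intervalIntegral.continuous_parametric_intervalIntegral_of_continuous
      (f := fun (z : ℝ × ℝ) r => W (z.1, z.1 + r)) ?_ ?_)
  · unfold Function.uncurry; fun_prop
  · exact (continuous_truncate L).comp (by fun_prop)

theorem diagPrimitive_diag (hL : 0 ≤ L) (a : ℝ) : diagPrimitive L p W (a, a) = p a := by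
  simp [diagPrimitive, truncate_of_abs_le, hL]

theorem abs_diagPrimitive_sub_le (hL : 0 ≤ L) {M : ℝ} (hM : ∀ z, |W z| ≤ M) (z : ℝ × ℝ) :
    |diagPrimitive L p W z - p z.1| ≤ L * M := by
  rw [diagPrimitive, add_sub_cancel_left]
  calc |∫ r in (0 : ℝ)..truncate L (z.2 - z.1), W (z.1, z.1 + r)|
      ≤ M * |truncate L (z.2 - z.1) - 0| :=
        intervalIntegral.norm_integral_le_of_norm_le_const
          (f := fun r => W (z.1, z.1 + r)) fun r _ => hM (z.1, z.1 + r)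
    _ ≤ M * L := by
        rw [sub_zero]
        exact mul_le_mul_of_nonneg_left (abs_truncate_le hL _) ((abs_nonneg _).trans (hM z))
    _ = L * M := mul_comm _ _

theorem abs_diagPrimitive_le (hL : 0 ≤ L) {m M : ℝ} (hp : ∀ a, |p a| ≤ m) (hM : ∀ z, |W z| ≤ M)
    (z : ℝ × ℝ) : |diagPrimitive L p W z| ≤ m + L * M := by
  have := abs_add_le (p z.1) (diagPrimitive L p W z - p z.1)
  rw [add_sub_cancel] at this
  linarith [hp z.1, abs_diagPrimitive_sub_le (p := p) hL hM z]

theorem abs_diagPrimitive_sub_diagPrimitive_le (hL : 0 ≤ L) (hW : Continuous W)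
    (hW' : Continuous W') {d : ℝ} (hd : ∀ z, |W z - W' z| ≤ d) (z : ℝ × ℝ) :
    |diagPrimitive L p W z - diagPrimitive L p W' z| ≤ L * d := by
  have : diagPrimitive L p W z - diagPrimitive L p W' z =
      diagPrimitive L p (fun z => W z - W' z) z - p z.1 := by
    simp only [diagPrimitive]
    rw [intervalIntegral.integral_sub]
    · ring
    · exact (by fun_prop : Continuous fun r => W (z.1, z.1 + r)).intervalIntegrable _ _
    · exact (by fun_prop : Continuous fun r => W' (z.1, z.1 + r)).intervalIntegrable _ _
  rw [this]
  exact abs_diagPrimitive_sub_le hL hd z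

theorem hasDerivAt_diagPrimitive (hW : Continuous W) {z : ℝ × ℝ} (hz : z ∈ diagStrip L) :
    HasDerivAt (fun b => diagPrimitive L p W (z.1, b)) (W z) z.2 := by
  obtain ⟨a, b⟩ := z
  have hc : Continuous fun r => W (a, a + r) := by fun_prop
  have untruncated : HasDerivAt (fun b' => ∫ r in (0 : ℝ)..b' - a, W (a, a + r)) (W (a, b)) b := by
    simpa [Function.comp_def] using ((hc.integral_hasStrictDerivAt 0 (b - a)).hasDerivAt.comp b
      ((hasDerivAt_id b).sub_const a))
  refine (untruncated.const_add (p a)).congr_of_eventuallyEq ?_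
  filter_upwards [((isOpen_diagStrip L).preimage (.prodMk_right a)).mem_nhds hz] with b' hb'
  have : |b' - a| ≤ L := by rw [abs_sub_comm]; exact (mem_diagStrip.1 hb').le
  simp only [diagPrimitive, truncate_of_abs_le this]

end DiagPrimitive

/-- `(P, Q)` solves the linear Goursat problem `P_b = Q_a = A P + B Q` on the strip
`|a - b| < L` with data `P = p`, `Q = q` on the diagonal; `W` is the common mixed derivative. -/
structure IsGoursatSolution (A B : ℝ × ℝ → ℝ) (p q : ℝ → ℝ) (L : ℝ) (P Q W : ℝ × ℝ → ℝ) :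
    Prop where
  continuous_fst : Continuous P
  continuous_snd : Continuous Q
  continuous_mixed : Continuous W
  hasDerivAt_fst : ∀ z ∈ diagStrip L, HasDerivAt (fun b => P (z.1, b)) (W z) z.2
  hasDerivAt_snd : ∀ z ∈ diagStrip L, HasDerivAt (fun a => Q (a, z.2)) (W z) z.1
  fst_diag : ∀ a, P (a, a) = p a
  snd_diag : ∀ a, Q (a, a) = q a
  mixed_eq : ∀ z, W z = A z * P z + B z * Q z

section Goursat

variable {A B : ℝ × ℝ → ℝ} {p q : ℝ → ℝ} {L κ m : ℝ}

/-- The map `W ↦ A P + B Q`, where `P` and `Q` are the primitives of `W` in the two variables with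
data `p` and `q` on the diagonal; its fixed points solve the Goursat problem. -/
noncomputable def goursatMap (A B : ℝ × ℝ → ℝ) (p q : ℝ → ℝ) (L : ℝ) (W : ℝ × ℝ → ℝ)
    (z : ℝ × ℝ) : ℝ :=
  A z * diagPrimitive L p W z + B z * diagPrimitive L q (fun y => W y.swap) z.swap

theorem continuous_goursatMap (hA : Continuous A) (hB : Continuous B) (hp : Continuous p)
    (hq : Continuous q) {W : ℝ × ℝ → ℝ} (hW : Continuous W) :
    Continuous (goursatMap A B p q L W) := by
  have := continuous_diagPrimitive (L := L) hp hW
  have := continuous_diagPrimitive (L := L) (W := fun y => W y.swap) hq (by fun_prop)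
  unfold goursatMap
  fun_prop

theorem isGoursatSolution_of_goursatMap_eq (hp : Continuous p) (hq : Continuous q) (hL : 0 ≤ L)
    {W : ℝ × ℝ → ℝ} (hW : Continuous W) (hfix : ∀ z, goursatMap A B p q L W z = W z) :
    IsGoursatSolution A B p q L (diagPrimitive L p W)
      (fun z => diagPrimitive L q (fun y => W y.swap) z.swap) W where
  continuous_fst := continuous_diagPrimitive hp hW
  continuous_snd := (continuous_diagPrimitive hq (by fun_prop)).comp continuous_swap
  continuous_mixed := hW
  hasDerivAt_fst _ hz := hasDerivAt_diagPrimitive hW hz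
  hasDerivAt_snd _ hz :=
    hasDerivAt_diagPrimitive (W := fun y => W y.swap) (by fun_prop) (swap_mem_diagStrip hz)
  fst_diag := diagPrimitive_diag hL
  snd_diag := diagPrimitive_diag hL
  mixed_eq z := (hfix z).symm

theorem abs_add_mul_le {x₁ x₂ y₁ y₂ κ β : ℝ} (hx₁ : |x₁| ≤ κ) (hx₂ : |x₂| ≤ κ) (hy₁ : |y₁| ≤ β)
    (hy₂ : |y₂| ≤ β) : |x₁ * y₁ + x₂ * y₂| ≤ 2 * κ * β := by
  have hκ : 0 ≤ κ := (abs_nonneg _).trans hx₁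
  calc |x₁ * y₁ + x₂ * y₂| ≤ |x₁ * y₁| + |x₂ * y₂| := abs_add_le _ _
    _ = |x₁| * |y₁| + |x₂| * |y₂| := by rw [abs_mul, abs_mul]
    _ ≤ κ * β + κ * β := by gcongr
    _ = 2 * κ * β := by ring

theorem abs_goursatMap_le (hA : ∀ z, |A z| ≤ κ) (hB : ∀ z, |B z| ≤ κ) (hp : ∀ a, |p a| ≤ m)
    (hq : ∀ a, |q a| ≤ m) (hL : 0 ≤ L) {W : ℝ × ℝ → ℝ} {M : ℝ} (hM : ∀ z, |W z| ≤ M)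
    (z : ℝ × ℝ) : |goursatMap A B p q L W z| ≤ 2 * κ * (m + L * M) :=
  abs_add_mul_le (hA z) (hB z) (abs_diagPrimitive_le hL hp hM z)
    (abs_diagPrimitive_le hL hq (fun y => hM y.swap) z.swap)

theorem abs_goursatMap_sub_le (hA : ∀ z, |A z| ≤ κ) (hB : ∀ z, |B z| ≤ κ) (hL : 0 ≤ L)
    {W W' : ℝ × ℝ → ℝ} (hW : Continuous W) (hW' : Continuous W') {d : ℝ}
    (hd : ∀ z, |W z - W' z| ≤ d) (z : ℝ × ℝ) :
    |goursatMap A B p q L W z - goursatMap A B p q L W' z| ≤ 2 * κ * (L * d) := by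
  have hP := abs_diagPrimitive_sub_diagPrimitive_le (p := p) hL hW hW' hd z
  have hQ := abs_diagPrimitive_sub_diagPrimitive_le (p := q) (W := fun y => W y.swap)
    (W' := fun y => W' y.swap) hL (by fun_prop) (by fun_prop) (fun y => hd y.swap) z.swap
  convert abs_add_mul_le (hA z) (hB z) hP hQ using 2
  simp only [goursatMap]
  ring

theorem exists_isGoursatSolution (hA : Continuous A) (hB : Continuous B) (hp : Continuous p)
    (hq : Continuous q) (hAκ : ∀ z, |A z| ≤ κ) (hBκ : ∀ z, |B z| ≤ κ) (hpm : ∀ a, |p a| ≤ m)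
    (hqm : ∀ a, |q a| ≤ m) (hL : 0 ≤ L) (hκL : κ * L ≤ 1 / 4) :
    ∃ P Q W, IsGoursatSolution A B p q L P Q W ∧ (∀ z, |P z - p z.1| ≤ L * (4 * κ * m)) ∧
      ∀ z, |Q z - q z.2| ≤ L * (4 * κ * m) := by
  have hκ : 0 ≤ κ := (abs_nonneg _).trans (hAκ 0)
  have hm : 0 ≤ m := (abs_nonneg _).trans (hpm 0)
  have bound (W : ℝ × ℝ →ᵇ ℝ) := abs_goursatMap_le hAκ hBκ hpm hqm hL W.norm_coe_le_norm
  let Φ : (ℝ × ℝ →ᵇ ℝ) → (ℝ × ℝ →ᵇ ℝ) := fun W => .ofNormedAddCommGroup (goursatMap A B p q L W)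
    (continuous_goursatMap hA hB hp hq W.continuous) _ (bound W)
  have contracting : ContractingWith (1 / 2) Φ := by
    refine ⟨by rw [div_lt_one] <;> norm_num, LipschitzWith.of_dist_le_mul fun W W' => ?_⟩
    refine (BoundedContinuousFunction.dist_le (by positivity)).2 fun z => ?_
    have : 0 ≤ dist W W' := dist_nonneg
    calc dist (Φ W z) (Φ W' z) ≤ 2 * κ * (L * dist W W') :=
          abs_goursatMap_sub_le hAκ hBκ hL W.continuous W'.continuous
            (BoundedContinuousFunction.dist_coe_le_dist (f := W) (g := W')) z
      _ ≤ ((1 / 2 : ℝ≥0) : ℝ) * dist W W' := by push_cast; nlinarith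
  obtain ⟨W, hW⟩ : ∃ W, Φ W = W := ⟨_, contracting.fixedPoint_isFixedPt⟩
  have norm_le : ‖W‖ ≤ 4 * κ * m := by
    have : ‖W‖ ≤ 2 * κ * (m + L * ‖W‖) := by
      conv_lhs => rw [← hW]
      exact (BoundedContinuousFunction.norm_le (by positivity)).2 (bound W)
    nlinarith [norm_nonneg W]
  have hWM (z : ℝ × ℝ) : |W z| ≤ 4 * κ * m := (W.norm_coe_le_norm z).trans norm_le
  exact ⟨_, _, W, isGoursatSolution_of_goursatMap_eq hp hq hL W.continuous (DFunLike.congr_fun hW),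
    abs_diagPrimitive_sub_le hL hWM,
    fun z => abs_diagPrimitive_sub_le (W := fun y => W y.swap) hL (fun y => hWM y.swap) z.swap⟩

end Goursat

/-! ### Characteristic coordinates -/

theorem exists_lipschitz_extension {s : Set (ℝ × ℝ)} (hs : Convex ℝ s) {f p q : ℝ × ℝ → ℝ}
    {K : ℝ≥0} (hf : ∀ z ∈ s, HasFDerivAt f (linForm (p z) (q z)) z)
    (hpq : ∀ z ∈ s, |p z| + |q z| ≤ K) : ∃ k : ℝ × ℝ → ℝ, LipschitzWith K k ∧ EqOn f k s :=
  LipschitzOnWith.extend_real (hs.lipschitzOnWith_of_nnnorm_hasFDerivWithin_le (𝕜 := ℝ)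
    (fun z hz => (hf z hz).hasFDerivWithinAt) fun z hz => (norm_linForm_le _ _).trans (hpq z hz))

theorem exists_homeomorph_of_lipschitzWith_sub {k : ℝ × ℝ → ℝ × ℝ} {K : ℝ≥0} (hK : K < 1)
    (hk : LipschitzWith K k) : ∃ H : (ℝ × ℝ) ≃ₜ (ℝ × ℝ), ∀ z, H z = z + k z := by
  let I := ContinuousLinearEquiv.refl ℝ (ℝ × ℝ)
  have approx : ApproximatesLinearOn (fun z => z + k z) (I : (ℝ × ℝ) →L[ℝ] (ℝ × ℝ)) univ K := by
    intro y _ z _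
    have : y + k y - (z + k z) - (I : (ℝ × ℝ) →L[ℝ] (ℝ × ℝ)) (y - z) = k y - k z := by
      change y + k y - (z + k z) - (y - z) = k y - k z
      abel
    rw [this, ← dist_eq_norm, ← dist_eq_norm]
    exact hk.dist_le_mul y z
  have norm_symm : ‖(I.symm : (ℝ × ℝ) →L[ℝ] (ℝ × ℝ))‖₊ = 1 :=
    NNReal.eq ContinuousLinearMap.norm_id
  exact ⟨approx.toHomeomorph _ (.inr (by rwa [norm_symm, inv_one])), fun _ => rfl⟩

theorem exists_homeomorph_of_near_id {s : Set (ℝ × ℝ)} (hs : Convex ℝ s)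
    {g₁ g₂ p₁ q₁ p₂ q₂ : ℝ × ℝ → ℝ} {K : ℝ≥0} (hK : K < 1)
    (hg₁ : ∀ z ∈ s, HasFDerivAt g₁ (linForm (p₁ z) (q₁ z)) z)
    (hg₂ : ∀ z ∈ s, HasFDerivAt g₂ (linForm (p₂ z) (q₂ z)) z)
    (h₁ : ∀ z ∈ s, |p₁ z - 1| + |q₁ z| ≤ K) (h₂ : ∀ z ∈ s, |p₂ z| + |q₂ z - 1| ≤ K) :
    ∃ H : (ℝ × ℝ) ≃ₜ (ℝ × ℝ), EqOn H (fun z => (g₁ z, g₂ z)) s ∧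
      LipschitzWith K fun z => H z - z := by
  obtain ⟨k₁, lip₁, eq₁⟩ := exists_lipschitz_extension (f := fun z => g₁ z - z.1) hs
    (fun z hz => ((hg₁ z hz).sub hasFDerivAt_fst).congr_fderiv (by
      ext <;> simp : _ = linForm (p₁ z - 1) (q₁ z))) h₁
  obtain ⟨k₂, lip₂, eq₂⟩ := exists_lipschitz_extension (f := fun z => g₂ z - z.2) hs
    (fun z hz => ((hg₂ z hz).sub hasFDerivAt_snd).congr_fderiv (by
      ext <;> simp : _ = linForm (p₂ z) (q₂ z - 1))) h₂
  have lip : LipschitzWith K fun z => (k₁ z, k₂ z) := by simpa using lip₁.prodMk lip₂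
  obtain ⟨H, hH⟩ := exists_homeomorph_of_lipschitzWith_sub hK lip
  refine ⟨H, fun z hz => ?_, by simpa [hH] using lip⟩
  ext
  · simp [hH, ← eq₁ hz]
  · simp [hH, ← eq₂ hz]

theorem mem_diagStrip_of_near_id {H : ℝ × ℝ → ℝ × ℝ} {K : ℝ≥0} (hK : (K : ℝ) ≤ 1 / 2)
    (hH : LipschitzWith K fun z => H z - z) (hdiag : ∀ m, H (m, m) = (m, m)) {L : ℝ} {z : ℝ × ℝ}
    (hz : |(H z).1 - (H z).2| < L / 2) : z ∈ diagStrip L := by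
  obtain ⟨a, b⟩ := z
  set m := (a + b) / 2 with hm
  have dist_mid : dist (a, b) (m, m) ≤ |a - b| / 2 := by
    rw [Prod.dist_eq, Real.dist_eq, Real.dist_eq]
    refine max_le ?_ ?_
    · rw [show a - m = (a - b) / 2 by rw [hm]; ring, abs_div, abs_two]
    · rw [show b - m = -((a - b) / 2) by rw [hm]; ring, abs_neg, abs_div, abs_two]
  have near : ‖H (a, b) - (a, b)‖ ≤ 1 / 2 * (|a - b| / 2) := by
    have := hH.dist_le_mul (a, b) (m, m)
    simp only [hdiag, sub_self, dist_zero_right] at this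
    exact this.trans (by gcongr)
  have near₁ := abs_le.1 ((norm_fst_le _).trans near)
  have near₂ := abs_le.1 ((norm_snd_le _).trans near)
  simp only [Prod.fst_sub, Prod.snd_sub] at near₁ near₂
  rw [abs_lt] at hz
  rw [mem_diagStrip]
  rcases abs_cases (a - b) with h | h <;> linarith

/-- A wave speed `Λ`, given as a function of the characteristic coordinates, that is close to `1`
and whose partial derivatives `Λa`, `Λb` are continuous and bounded by `η`. -/
structure IsSlowSpeed (Λ Λa Λb : ℝ × ℝ → ℝ) (η : ℝ) : Prop where
  continuous : Continuous Λ
  continuous_fst : Continuous Λa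
  continuous_snd : Continuous Λb
  hasDerivAt_fst : ∀ z, HasDerivAt (fun a => Λ (a, z.2)) (Λa z) z.1
  hasDerivAt_snd : ∀ z, HasDerivAt (fun b => Λ (z.1, b)) (Λb z) z.2
  abs_sub_one_le : ∀ z, |Λ z - 1| ≤ 1 / 100
  abs_fst_le : ∀ z, |Λa z| ≤ η
  abs_snd_le : ∀ z, |Λb z| ≤ η

/-- `P = t_a` and `Q = t_b` are the derivatives of time with respect to the characteristic
coordinates `(a, b)`. Since `x_a = Λ t_a`, `x_b = -Λ t_b`, equality of the mixed derivatives of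
`x` gives the Goursat problem `2 Λ t_ab = -(Λ_b t_a + Λ_a t_b)`. -/
structure IsCharTime (Λ Λa Λb : ℝ × ℝ → ℝ) (L : ℝ) (P Q W : ℝ × ℝ → ℝ) : Prop
    extends IsGoursatSolution (fun z => -Λb z / (2 * Λ z)) (fun z => -Λa z / (2 * Λ z))
      (fun a => 1 / (2 * Λ (a, a))) (fun a => -(1 / (2 * Λ (a, a)))) L P Q W where
  abs_fst_sub_le : ∀ z, |P z - 1 / 2| ≤ 1 / 50
  abs_snd_add_le : ∀ z, |Q z + 1 / 2| ≤ 1 / 50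

/-- Characteristic coordinates `α`, `β` for the speed `Λ` up to time `L / 4`: they are transported
by `α_t = Λ(α, β) α_x`, `β_t = -Λ(α, β) β_x` and start from `α = β = x`. -/
structure IsCharCoords (Λ : ℝ × ℝ → ℝ) (L : ℝ) (α β αx βx : ℝ × ℝ → ℝ) : Prop where
  continuous_α : Continuous α
  continuous_β : Continuous β
  continuous_αx : Continuous αx
  continuous_βx : Continuous βx
  abs_αx_le : ∀ z, |αx z| ≤ 2
  abs_βx_le : ∀ z, |βx z| ≤ 2
  initial_α : ∀ x, α (0, x) = x
  initial_β : ∀ x, β (0, x) = x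
  deriv_α_x : ∀ t x, |t| < L / 4 → HasDerivAt (fun y => α (t, y)) (αx (t, x)) x
  deriv_β_x : ∀ t x, |t| < L / 4 → HasDerivAt (fun y => β (t, y)) (βx (t, x)) x
  deriv_α_t : ∀ t x, |t| < L / 4 →
    HasDerivAt (fun s => α (s, x)) (Λ (α (t, x), β (t, x)) * αx (t, x)) t
  deriv_β_t : ∀ t x, |t| < L / 4 →
    HasDerivAt (fun s => β (s, x)) (-(Λ (α (t, x), β (t, x)) * βx (t, x))) t

theorem mem_Icc_of_abs_sub_one_le {y : ℝ} (h : |y - 1| ≤ 1 / 100) :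
    y ∈ Icc (99 / 100) (101 / 100) := by
  have := abs_le.1 h
  constructor <;> linarith

section CharCoords

variable {Λ Λa Λb P Q W : ℝ × ℝ → ℝ} {η L : ℝ}

namespace IsSlowSpeed

theorem mem_Icc (h : IsSlowSpeed Λ Λa Λb η) (z : ℝ × ℝ) : Λ z ∈ Icc (99 / 100) (101 / 100) :=
  mem_Icc_of_abs_sub_one_le (h.abs_sub_one_le z)

theorem ne_zero (h : IsSlowSpeed Λ Λa Λb η) (z : ℝ × ℝ) : Λ z ≠ 0 :=
  ne_of_gt (by linarith [(h.mem_Icc z).1])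

theorem abs_neg_div_le (h : IsSlowSpeed Λ Λa Λb η) {y : ℝ} (hy : |y| ≤ η) (z : ℝ × ℝ) :
    |-y / (2 * Λ z)| ≤ η := by
  have hΛ := (h.mem_Icc z).1
  rw [abs_div, abs_neg, abs_of_pos (by linarith : 0 < 2 * Λ z), div_le_iff₀ (by linarith)]
  nlinarith [abs_nonneg y]

theorem abs_one_div_sub_le (h : IsSlowSpeed Λ Λa Λb η) (z : ℝ × ℝ) :
    |1 / (2 * Λ z) - 1 / 2| ≤ 6 / 1000 := by
  have hΛ := (h.mem_Icc z).1
  have : 1 / (2 * Λ z) - 1 / 2 = (1 - Λ z) / (2 * Λ z) := by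
    have := h.ne_zero z
    field_simp
  rw [this, abs_div, abs_of_pos (by linarith : 0 < 2 * Λ z), div_le_iff₀ (by linarith),
    abs_sub_comm]
  linarith [h.abs_sub_one_le z]

theorem exists_isCharTime (h : IsSlowSpeed Λ Λa Λb η) (hL : 0 ≤ L) (hηL : η * L ≤ 1 / 200) :
    ∃ P Q W, IsCharTime Λ Λa Λb L P Q W := by
  have hΛ := h.continuous
  have hΛa := h.continuous_fst
  have hΛb := h.continuous_snd
  have hne (z : ℝ × ℝ) : 2 * Λ z ≠ 0 := mul_ne_zero two_ne_zero (h.ne_zero z)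
  have hdiag (a : ℝ) : |1 / (2 * Λ (a, a))| ≤ 6 / 10 := by
    have := abs_le.1 (h.abs_one_div_sub_le (a, a))
    rw [abs_le]
    constructor <;> linarith
  have hcont : Continuous fun a => 1 / (2 * Λ (a, a)) :=
    continuous_const.div (by fun_prop) fun a => hne (a, a)
  obtain ⟨P, Q, W, hPQ, hP, hQ⟩ := exists_isGoursatSolution (κ := η)
    (A := fun z => -Λb z / (2 * Λ z)) (B := fun z => -Λa z / (2 * Λ z))
    (hΛb.neg.div (by fun_prop) hne) (hΛa.neg.div (by fun_prop) hne) hcont hcont.neg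
    (fun z => h.abs_neg_div_le (h.abs_snd_le z) z) (fun z => h.abs_neg_div_le (h.abs_fst_le z) z)
    hdiag (fun a => by simpa using hdiag a) hL (by linarith)
  have : L * (4 * η * (6 / 10)) ≤ 12 / 1000 := by linarith
  refine ⟨P, Q, W, hPQ, fun z => ?_, fun z => ?_⟩
  · have hd := abs_le.1 (h.abs_one_div_sub_le (z.1, z.1))
    have hz := abs_le.1 (hP z)
    rw [abs_le]
    constructor <;> linarith
  · have hd := abs_le.1 (h.abs_one_div_sub_le (z.2, z.2))
    have hz := abs_le.1 (hQ z)
    rw [Pi.neg_apply] at hz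
    rw [abs_le]
    constructor <;> linarith

end IsSlowSpeed

namespace IsCharTime

theorem fst_mem_Icc (hT : IsCharTime Λ Λa Λb L P Q W) (z : ℝ × ℝ) :
    P z ∈ Icc (48 / 100) (52 / 100) := by
  have := abs_le.1 (hT.abs_fst_sub_le z)
  constructor <;> linarith

theorem snd_mem_Icc (hT : IsCharTime Λ Λa Λb L P Q W) (z : ℝ × ℝ) :
    Q z ∈ Icc (-(52 / 100)) (-(48 / 100)) := by
  have := abs_le.1 (hT.abs_snd_add_le z)
  constructor <;> linarith

theorem half_le_mul_fst (hT : IsCharTime Λ Λa Λb L P Q W) (h : IsSlowSpeed Λ Λa Λb η)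
    (z : ℝ × ℝ) : 1 / 2 ≤ 2 * Λ z * P z := by
  nlinarith [(h.mem_Icc z).1, (hT.fst_mem_Icc z).1]

theorem mul_snd_le_neg_half (hT : IsCharTime Λ Λa Λb L P Q W) (h : IsSlowSpeed Λ Λa Λb η)
    (z : ℝ × ℝ) : 2 * Λ z * Q z ≤ -(1 / 2) := by
  nlinarith [(h.mem_Icc z).1, (hT.snd_mem_Icc z).2]

theorem fst_ne_zero (hT : IsCharTime Λ Λa Λb L P Q W) (z : ℝ × ℝ) : P z ≠ 0 :=
  ne_of_gt (by linarith [(hT.fst_mem_Icc z).1])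

theorem snd_ne_zero (hT : IsCharTime Λ Λa Λb L P Q W) (z : ℝ × ℝ) : Q z ≠ 0 :=
  ne_of_lt (by linarith [(hT.snd_mem_Icc z).2])

theorem two_mul_mixed_eq (hT : IsCharTime Λ Λa Λb L P Q W) (h : IsSlowSpeed Λ Λa Λb η)
    (z : ℝ × ℝ) : 2 * Λ z * W z = -(Λb z * P z + Λa z * Q z) := by
  have := h.ne_zero z
  rw [hT.mixed_eq]
  field_simp
  ring

theorem exists_fst_potential (hT : IsCharTime Λ Λa Λb L P Q W) (h : IsSlowSpeed Λ Λa Λb η) :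
    ∃ g : ℝ × ℝ → ℝ, (∀ m, g (m, m) = m) ∧
      ∀ z ∈ diagStrip L, HasFDerivAt g (linForm ((Λ z + 1) * P z) ((1 - Λ z) * Q z)) z := by
  have := h.continuous
  have := h.continuous_snd
  have := hT.continuous_fst
  have := hT.continuous_snd
  have := hT.continuous_mixed
  refine exists_potential_diagStrip (W := fun z => Λb z * P z + (Λ z + 1) * W z) (D := id)
    (by fun_prop) (by fun_prop) (by fun_prop)
    (fun z hz => ((h.hasDerivAt_snd z).add_const 1).mul (hT.hasDerivAt_fst z hz))
    (fun z hz => (((h.hasDerivAt_fst z).const_sub 1).mul (hT.hasDerivAt_snd z hz)).congr_deriv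
      (by linear_combination -hT.two_mul_mixed_eq h z))
    (fun a => (hasDerivAt_id a).congr_deriv ?_)
  rw [hT.fst_diag, hT.snd_diag]
  have := h.ne_zero (a, a)
  field_simp
  ring

theorem exists_snd_potential (hT : IsCharTime Λ Λa Λb L P Q W) (h : IsSlowSpeed Λ Λa Λb η) :
    ∃ g : ℝ × ℝ → ℝ, (∀ m, g (m, m) = m) ∧
      ∀ z ∈ diagStrip L, HasFDerivAt g (linForm ((Λ z - 1) * P z) (-((Λ z + 1) * Q z))) z := by
  have := h.continuous
  have := h.continuous_snd
  have := hT.continuous_fst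
  have := hT.continuous_snd
  have := hT.continuous_mixed
  refine exists_potential_diagStrip (W := fun z => Λb z * P z + (Λ z - 1) * W z) (D := id)
    (by fun_prop) (by fun_prop) (by fun_prop)
    (fun z hz => ((h.hasDerivAt_snd z).sub_const 1).mul (hT.hasDerivAt_fst z hz))
    (fun z hz => (((h.hasDerivAt_fst z).add_const 1).mul (hT.hasDerivAt_snd z hz)).neg.congr_deriv
      (by linear_combination -hT.two_mul_mixed_eq h z))
    (fun a => (hasDerivAt_id a).congr_deriv ?_)
  rw [hT.fst_diag, hT.snd_diag]
  have := h.ne_zero (a, a)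
  field_simp
  ring

theorem abs_fst_potential_le (hT : IsCharTime Λ Λa Λb L P Q W) (h : IsSlowSpeed Λ Λa Λb η)
    (z : ℝ × ℝ) : |(Λ z + 1) * P z - 1| + |(1 - Λ z) * Q z| ≤ 1 / 10 := by
  have hΛ := h.mem_Icc z
  have hP := hT.fst_mem_Icc z
  have hQ := hT.snd_mem_Icc z
  have diagonal : |(Λ z + 1) * P z - 1| ≤ 5 / 100 := by
    rw [abs_le]; constructor <;> nlinarith [hΛ.1, hΛ.2, hP.1, hP.2]
  have offDiagonal : |(1 - Λ z) * Q z| ≤ 1 / 100 := by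
    rw [abs_le]; constructor <;> nlinarith [hΛ.1, hΛ.2, hQ.1, hQ.2]
  linarith

theorem abs_snd_potential_le (hT : IsCharTime Λ Λa Λb L P Q W) (h : IsSlowSpeed Λ Λa Λb η)
    (z : ℝ × ℝ) : |(Λ z - 1) * P z| + |-((Λ z + 1) * Q z) - 1| ≤ 1 / 10 := by
  have hΛ := h.mem_Icc z
  have hP := hT.fst_mem_Icc z
  have hQ := hT.snd_mem_Icc z
  have diagonal : |-((Λ z + 1) * Q z) - 1| ≤ 5 / 100 := by
    rw [abs_le]; constructor <;> nlinarith [hΛ.1, hΛ.2, hQ.1, hQ.2]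
  have offDiagonal : |(Λ z - 1) * P z| ≤ 1 / 100 := by
    rw [abs_le]; constructor <;> nlinarith [hΛ.1, hΛ.2, hP.1, hP.2]
  linarith

/-- On the strip, `H (a, b) = (x + t, x - t)`: in these variables the characteristic map is close
to the identity and hence extends to a homeomorphism of the plane. -/
theorem exists_homeomorph (hT : IsCharTime Λ Λa Λb L P Q W) (h : IsSlowSpeed Λ Λa Λb η)
    (hL : 0 < L) :
    ∃ H : (ℝ × ℝ) ≃ₜ (ℝ × ℝ), (∀ m, H (m, m) = (m, m)) ∧
      (∀ z, |(H z).1 - (H z).2| < L / 2 → z ∈ diagStrip L) ∧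
      ∀ z ∈ diagStrip L, HasFDerivAt H ((linForm ((Λ z + 1) * P z) ((1 - Λ z) * Q z)).prod
        (linForm ((Λ z - 1) * P z) (-((Λ z + 1) * Q z)))) z := by
  obtain ⟨g₁, diag₁, hg₁⟩ := hT.exists_fst_potential h
  obtain ⟨g₂, diag₂, hg₂⟩ := hT.exists_snd_potential h
  obtain ⟨H, hH, lip⟩ := exists_homeomorph_of_near_id (K := 1 / 10) (convex_diagStrip L)
    (by rw [div_lt_one] <;> norm_num) hg₁ hg₂
    (fun z _ => by simpa using hT.abs_fst_potential_le h z)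
    (fun z _ => by simpa using hT.abs_snd_potential_le h z)
  have hdiag (m : ℝ) : H (m, m) = (m, m) := by simp [hH (diag_mem_diagStrip hL m), diag₁, diag₂]
  refine ⟨H, hdiag, fun z => mem_diagStrip_of_near_id (by norm_num) lip hdiag, fun z hz => ?_⟩
  exact ((hg₁ z hz).prodMk (hg₂ z hz)).congr_of_eventuallyEq
    (hH.eventuallyEq_of_mem ((isOpen_diagStrip L).mem_nhds hz))

theorem hasFDerivAt_homeomorph_symm (hT : IsCharTime Λ Λa Λb L P Q W)
    (h : IsSlowSpeed Λ Λa Λb η) {H : (ℝ × ℝ) ≃ₜ (ℝ × ℝ)} {z w : ℝ × ℝ} (hw : H.symm w = z)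
    (hH : HasFDerivAt H ((linForm ((Λ z + 1) * P z) ((1 - Λ z) * Q z)).prod
        (linForm ((Λ z - 1) * P z) (-((Λ z + 1) * Q z)))) z) :
    HasFDerivAt H.symm
      ((linForm ((Λ z + 1) / (4 * Λ z * P z)) ((1 - Λ z) / (4 * Λ z * P z))).prod
        (linForm ((Λ z - 1) / (4 * Λ z * Q z)) (-(Λ z + 1) / (4 * Λ z * Q z)))) w := by
  have hΛ := h.ne_zero z
  have hP := hT.fst_ne_zero z
  have hQ := hT.snd_ne_zero z
  subst hw
  refine (hasFDerivAt_planar_inverse (δ := -(4 * Λ (H.symm w) * P (H.symm w) * Q (H.symm w)))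
    (by simp [hΛ, hP, hQ]) (by ring) H.symm.continuous.continuousAt hH
    (.of_forall H.apply_symm_apply)).congr_fderiv ?_
  congr 2 <;> field_simp

theorem exists_charMap (hT : IsCharTime Λ Λa Λb L P Q W) (h : IsSlowSpeed Λ Λa Λb η)
    (hL : 0 < L) :
    ∃ γ : ℝ × ℝ → ℝ × ℝ, Continuous γ ∧ (∀ x, γ (0, x) = (x, x)) ∧ ∀ t x, |t| < L / 4 →
      HasDerivAt (fun y => γ (t, y))
        (1 / (2 * Λ (γ (t, x)) * P (γ (t, x))), -(1 / (2 * Λ (γ (t, x)) * Q (γ (t, x))))) x ∧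
      HasDerivAt (fun s => γ (s, x)) (1 / (2 * P (γ (t, x))), 1 / (2 * Q (γ (t, x)))) t := by
  obtain ⟨H, hdiag, hstrip, hH⟩ := hT.exists_homeomorph h hL
  refine ⟨fun w => H.symm (w.2 + w.1, w.2 - w.1), H.symm.continuous.comp (by fun_prop),
    fun x => by simpa using H.symm_apply_eq.2 (hdiag x).symm, fun t x ht => ?_⟩
  generalize hz : H.symm (x + t, x - t) = z
  have hzL : z ∈ diagStrip L := hstrip z (by
    rw [← hz, H.apply_symm_apply, show x + t - (x - t) = 2 * t by ring, abs_mul, abs_two]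
    linarith)
  have hsymm := hT.hasFDerivAt_homeomorph_symm h hz (hH z hzL)
  have hΛ := h.ne_zero z
  have hP := hT.fst_ne_zero z
  have hQ := hT.snd_ne_zero z
  refine ⟨(hsymm.comp_hasDerivAt x
    (((hasDerivAt_id x).add_const t).prodMk ((hasDerivAt_id x).sub_const t))).congr_deriv ?_,
    (hsymm.comp_hasDerivAt t
    (((hasDerivAt_id t).const_add x).prodMk ((hasDerivAt_id t).const_sub x))).congr_deriv ?_⟩ <;>
  · simp only [hz]
    ext <;> simp only [ContinuousLinearMap.prod_apply, linForm_apply] <;> field_simp <;> ring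

end IsCharTime

theorem IsSlowSpeed.exists_isCharCoords (h : IsSlowSpeed Λ Λa Λb η) (hL : 0 < L)
    (hηL : η * L ≤ 1 / 200) : ∃ α β αx βx, IsCharCoords Λ L α β αx βx := by
  obtain ⟨P, Q, W, hT⟩ := h.exists_isCharTime hL.le hηL
  obtain ⟨γ, hγ, initial, deriv_γ⟩ := hT.exists_charMap h hL
  have hΛ := h.continuous
  have hP := hT.continuous_fst
  have hQ := hT.continuous_snd
  have hΛP := hT.half_le_mul_fst h
  have hΛQ := hT.mul_snd_le_neg_half h
  refine ⟨fun w => (γ w).1, fun w => (γ w).2, fun w => 1 / (2 * Λ (γ w) * P (γ w)),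
    fun w => -(1 / (2 * Λ (γ w) * Q (γ w))), by fun_prop, by fun_prop,
    continuous_const.div (by fun_prop) fun w => ne_of_gt (by linarith [hΛP (γ w)]),
    (continuous_const.div (by fun_prop) fun w => ne_of_lt (by linarith [hΛQ (γ w)])).neg,
    fun w => ?_, fun w => ?_, fun x => by simp [initial], fun x => by simp [initial],
    fun t x ht => (hasFDerivAt_fst.comp_hasDerivAt x (deriv_γ t x ht).1).congr_deriv rfl,
    fun t x ht => (hasFDerivAt_snd.comp_hasDerivAt x (deriv_γ t x ht).1).congr_deriv rfl,
    fun t x ht => (hasFDerivAt_fst.comp_hasDerivAt t (deriv_γ t x ht).2).congr_deriv ?_,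
    fun t x ht => (hasFDerivAt_snd.comp_hasDerivAt t (deriv_γ t x ht).2).congr_deriv ?_⟩
  · have := hΛP (γ w)
    rw [abs_div, abs_one, abs_of_pos (by linarith), div_le_iff₀ (by linarith)]
    linarith
  · have := hΛQ (γ w)
    rw [abs_neg, abs_div, abs_one, abs_of_neg (by linarith), div_le_iff₀ (by linarith)]
    linarith
  all_goals
    have := h.ne_zero (γ (t, x))
    have := hT.fst_ne_zero (γ (t, x))
    have := hT.snd_ne_zero (γ (t, x))
    simp only [ContinuousLinearMap.coe_fst', ContinuousLinearMap.coe_snd', Prod.mk.eta]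
    field_simp

end CharCoords

/-! ### Solutions for a slowly varying wave speed -/

section SlowWave

variable {k F V S R f g : ℝ → ℝ} {b m η L T : ℝ}

theorem exists_antideriv_surjective (hk : Continuous k) (hk1 : ∀ θ, |k θ - 1| ≤ 1 / 100) :
    ∃ F : ℝ → ℝ, (∀ θ, HasDerivAt F (k θ) θ) ∧ Function.Surjective F ∧
      ∀ θ, |F θ - θ| ≤ 1 / 100 * |θ| := by
  set F : ℝ → ℝ := fun θ => ∫ y in (0 : ℝ)..θ, k y
  have hF (θ : ℝ) : HasDerivAt F (k θ) θ := (hk.integral_hasStrictDerivAt 0 θ).hasDerivAt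
  have F_near (θ : ℝ) : |F θ - θ| ≤ 1 / 100 * |θ| := by
    have sub_eq : F θ - θ = ∫ y in (0 : ℝ)..θ, (k y - 1) := by
      rw [intervalIntegral.integral_sub (hk.intervalIntegrable _ _) intervalIntegrable_const]
      simp [F]
    simpa [sub_eq] using intervalIntegral.norm_integral_le_of_norm_le_const (a := 0) (b := θ)
      (f := fun y => k y - 1) (fun y _ => hk1 y)
  have hFc : Continuous F := continuous_iff_continuousAt.2 fun θ => (hF θ).continuousAt
  refine ⟨F, hF, hFc.surjective ?_ ?_, F_near⟩
  · refine tendsto_atTop_mono' atTop ?_ ((tendsto_id (α := ℝ)).atTop_div_const two_pos)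
    filter_upwards [eventually_ge_atTop 0] with θ hθ
    have := abs_le.1 ((F_near θ).trans_eq (by rw [abs_of_nonneg hθ]))
    simp only [id]
    linarith
  · refine tendsto_atBot_mono' atBot ?_ ((tendsto_id (α := ℝ)).atBot_div_const two_pos)
    filter_upwards [eventually_le_atBot 0] with θ hθ
    have := abs_le.1 ((F_near θ).trans_eq (by rw [abs_of_nonpos hθ]))
    simp only [id]
    linarith

/-- `F` is a primitive of the wave speed `k`, and `V` is its inverse. The Riemann invariants of
the wave equation are `u_t ± F(u_x)`. -/
structure IsSpeedPrimitive (k F V : ℝ → ℝ) : Prop where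
  hasDerivAt : ∀ θ, HasDerivAt F (k θ) θ
  hasDerivAt_inv : ∀ z, HasDerivAt V (k (V z))⁻¹ z
  leftInverse : Function.LeftInverse V F
  abs_le : ∀ θ, |F θ| ≤ 2 * |θ|
  abs_inv_le : ∀ z, |V z| ≤ 2 * |z|

theorem exists_isSpeedPrimitive (hk : Continuous k) (hk1 : ∀ θ, |k θ - 1| ≤ 1 / 100) :
    ∃ F V, IsSpeedPrimitive k F V := by
  obtain ⟨F, hF, surj, F_near⟩ := exists_antideriv_surjective hk hk1
  have k_pos (θ : ℝ) : 0 < k θ := by linarith [(mem_Icc_of_abs_sub_one_le (hk1 θ)).1]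
  have mono : StrictMono F := strictMono_of_hasDerivAt_pos hF k_pos
  let e := (mono.orderIsoOfSurjective F surj).toHomeomorph
  have F_symm (z : ℝ) : F (e.symm z) = z := e.apply_symm_apply z
  refine ⟨F, e.symm, hF, fun z => ?_, e.symm_apply_apply, fun θ => ?_, fun z => ?_⟩
  · exact .of_local_left_inverse e.symm.continuous.continuousAt (hF _) (k_pos _).ne'
      (.of_forall F_symm)
  · linarith [abs_sub_abs_le_abs_sub (F θ) θ, F_near θ, abs_nonneg θ]
  · have near := F_near (e.symm z)
    rw [F_symm, abs_sub_comm] at near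
    linarith [abs_sub_abs_le_abs_sub (e.symm z) z, abs_nonneg z]

/-- A `C¹` function which, together with its derivative, is bounded by `m`. -/
structure IsBoundedC1 (f : ℝ → ℝ) (m : ℝ) : Prop where
  contDiff : ContDiff ℝ 1 f
  abs_le : ∀ x, |f x| ≤ m
  abs_deriv_le : ∀ x, |deriv f x| ≤ m

namespace IsBoundedC1

theorem hasDerivAt (hf : IsBoundedC1 f m) (x : ℝ) : HasDerivAt f (deriv f x) x :=
  (hf.contDiff.differentiable one_ne_zero x).hasDerivAt

theorem continuous (hf : IsBoundedC1 f m) : Continuous f := hf.contDiff.continuous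

theorem continuous_deriv (hf : IsBoundedC1 f m) : Continuous (deriv f) :=
  hf.contDiff.continuous_deriv_one

theorem nonneg (hf : IsBoundedC1 f m) : 0 ≤ m := (abs_nonneg _).trans (hf.abs_le 0)

theorem mono (hf : IsBoundedC1 f m) (hmb : m ≤ b) : IsBoundedC1 f b :=
  ⟨hf.contDiff, fun x => (hf.abs_le x).trans hmb, fun x => (hf.abs_deriv_le x).trans hmb⟩

theorem neg (hf : IsBoundedC1 f m) : IsBoundedC1 (fun x => -f x) m :=
  ⟨hf.contDiff.neg, by simpa using hf.abs_le, by simpa [deriv.fun_neg'] using hf.abs_deriv_le⟩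

theorem add (hf : IsBoundedC1 f m) (hg : IsBoundedC1 g b) :
    IsBoundedC1 (fun x => f x + g x) (m + b) where
  contDiff := hf.contDiff.add hg.contDiff
  abs_le x := (abs_add_le _ _).trans (add_le_add (hf.abs_le x) (hg.abs_le x))
  abs_deriv_le x := by
    rw [((hf.hasDerivAt x).fun_add (hg.hasDerivAt x)).deriv]
    exact (abs_add_le _ _).trans (add_le_add (hf.abs_deriv_le x) (hg.abs_deriv_le x))

theorem const_mul {ε : ℝ} (hf : IsBoundedC1 f m) (hε : 0 ≤ ε) :
    IsBoundedC1 (fun x => ε * f x) (ε * m) where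
  contDiff := contDiff_const.mul hf.contDiff
  abs_le x := by
    rw [abs_mul, abs_of_nonneg hε]
    exact mul_le_mul_of_nonneg_left (hf.abs_le x) hε
  abs_deriv_le x := by
    rw [deriv_const_mul_field, abs_mul, abs_of_nonneg hε]
    exact mul_le_mul_of_nonneg_left (hf.abs_deriv_le x) hε

theorem speedPrimitive_comp (hf : IsBoundedC1 f m) (hk : Continuous k)
    (hk1 : ∀ θ, |k θ - 1| ≤ 1 / 100) (hF : IsSpeedPrimitive k F V) :
    IsBoundedC1 (fun x => F (f x)) (2 * m) where
  contDiff := by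
    have deriv_F : deriv F = k := funext fun θ => (hF.hasDerivAt θ).deriv
    exact (contDiff_one_iff_deriv.2
      ⟨fun θ => (hF.hasDerivAt θ).differentiableAt, deriv_F ▸ hk⟩).comp hf.contDiff
  abs_le x := (hF.abs_le _).trans (by linarith [hf.abs_le x])
  abs_deriv_le x := by
    have hk_mem := mem_Icc_of_abs_sub_one_le (hk1 (f x))
    have : HasDerivAt (fun x => F (f x)) (k (f x) * deriv f x) x :=
      (hF.hasDerivAt _).comp x (hf.hasDerivAt x)
    rw [this.deriv, abs_mul, abs_of_pos (by linarith [hk_mem.1])]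
    exact mul_le_mul (by linarith [hk_mem.2]) (hf.abs_deriv_le x) (abs_nonneg _) two_pos.le

end IsBoundedC1

theorem abs_inv_le_two {y : ℝ} (h : |y - 1| ≤ 1 / 100) : |y⁻¹| ≤ 2 := by
  have := (mem_Icc_of_abs_sub_one_le h).1
  rw [abs_inv, abs_of_pos (by linarith)]
  exact inv_le_of_inv_le₀ two_pos (by linarith)

/-- `(S a - R b) / 2` is the value of `F(u_x)` where the Riemann invariants are `S a` and `R b`. -/
theorem IsSpeedPrimitive.abs_inv_half_sub_le (hF : IsSpeedPrimitive k F V) (hS : IsBoundedC1 S b)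
    (hR : IsBoundedC1 R b) (x y : ℝ) : |V ((S x - R y) / 2)| ≤ 2 * b := by
  refine (hF.abs_inv_le _).trans ?_
  rw [abs_div, abs_two]
  linarith [abs_sub (S x) (R y), hS.abs_le x, hR.abs_le y]

theorem IsSpeedPrimitive.isSlowSpeed (hF : IsSpeedPrimitive k F V) (hk : ContDiff ℝ 1 k)
    (hk1 : ∀ θ, |k θ - 1| ≤ 1 / 100) (hS : IsBoundedC1 S b) (hR : IsBoundedC1 R b) (hb : b ≤ 1)
    (hη : ∀ θ, |θ| ≤ 2 * b → |deriv k θ| ≤ η) :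
    IsSlowSpeed (fun z => k (V ((S z.1 - R z.2) / 2)))
      (fun z => deriv k (V ((S z.1 - R z.2) / 2)) *
        ((k (V ((S z.1 - R z.2) / 2)))⁻¹ * (deriv S z.1 / 2)))
      (fun z => deriv k (V ((S z.1 - R z.2) / 2)) *
        ((k (V ((S z.1 - R z.2) / 2)))⁻¹ * (-deriv R z.2 / 2))) η := by
  have hVc : Continuous V :=
    continuous_iff_continuousAt.2 fun z => (hF.hasDerivAt_inv z).continuousAt
  have hkc := hk.continuous
  have := hk.continuous_deriv_one
  have hSc := hS.continuous
  have hRc := hR.continuous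
  have hSc' := hS.continuous_deriv
  have hRc' := hR.continuous_deriv
  have k_ne (θ : ℝ) : k θ ≠ 0 := ne_of_gt (by linarith [(mem_Icc_of_abs_sub_one_le (hk1 θ)).1])
  have slow (z : ℝ × ℝ) {s : ℝ} (hs : |s| ≤ b) :
      |deriv k (V ((S z.1 - R z.2) / 2)) * ((k (V ((S z.1 - R z.2) / 2)))⁻¹ * (s / 2))| ≤ η := by
    have hk' := hη _ (hF.abs_inv_half_sub_le hS hR z.1 z.2)
    have hs1 : |s / 2| ≤ 1 / 2 := by rw [abs_div, abs_two]; linarith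
    calc _ ≤ η * (2 * (1 / 2)) := by
          rw [abs_mul, abs_mul]
          have := abs_inv_le_two (hk1 (V ((S z.1 - R z.2) / 2)))
          gcongr
          exact (abs_nonneg _).trans hk'
      _ = η := by ring
  have hkd (θ : ℝ) := (hk.differentiable one_ne_zero θ).hasDerivAt
  have inv_cont : Continuous fun z : ℝ × ℝ => (k (V ((S z.1 - R z.2) / 2)))⁻¹ :=
    Continuous.inv₀ (by fun_prop) fun _ => k_ne _
  exact ⟨by fun_prop, by fun_prop, by fun_prop,
    fun z => (hkd _).comp z.1 ((hF.hasDerivAt_inv _).comp z.1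
      (((hS.hasDerivAt z.1).sub_const (R z.2)).div_const 2)),
    fun z => (hkd _).comp z.2 ((hF.hasDerivAt_inv _).comp z.2
      (((hR.hasDerivAt z.2).const_sub (S z.1)).div_const 2)),
    fun z => hk1 _, fun z => slow z (hS.abs_deriv_le _),
    fun z => slow z (by simpa using hR.abs_deriv_le z.2)⟩

/-- A solution `v = u_x`, `w = u_t` for `|t| < T` of the system `v_t = w_x`, `w_t = k(v)² v_x` with
initial values `v₀`, `w₀`; here `X = w_x` and `Y = k(v) v_x`. -/
structure IsSystemSolution (k v₀ w₀ : ℝ → ℝ) (b T : ℝ) (v w X Y : ℝ × ℝ → ℝ) : Prop where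
  continuous_v : Continuous v
  continuous_w : Continuous w
  continuous_X : Continuous X
  continuous_Y : Continuous Y
  abs_v_le : ∀ z, |v z| ≤ 2 * b
  abs_w_le : ∀ z, |w z| ≤ b
  abs_X_le : ∀ z, |X z| ≤ 2 * b
  abs_Y_le : ∀ z, |Y z| ≤ 2 * b
  initial_v : ∀ x, v (0, x) = v₀ x
  initial_w : ∀ x, w (0, x) = w₀ x
  deriv_v_t : ∀ t x, |t| < T → HasDerivAt (fun s => v (s, x)) (X (t, x)) t
  deriv_w_t : ∀ t x, |t| < T → HasDerivAt (fun s => w (s, x)) (k (v (t, x)) * Y (t, x)) t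
  deriv_v_x : ∀ t x, |t| < T → HasDerivAt (fun y => v (t, y)) ((k (v (t, x)))⁻¹ * Y (t, x)) x
  deriv_w_x : ∀ t x, |t| < T → HasDerivAt (fun y => w (t, y)) (X (t, x)) x

/-- In characteristic coordinates the Riemann invariants `S(α)` and `R(β)` are constant along
characteristics by construction. -/
theorem IsCharCoords.isSystemSolution {α β αx βx : ℝ × ℝ → ℝ} (hF : IsSpeedPrimitive k F V)
    (hk1 : ∀ θ, |k θ - 1| ≤ 1 / 100) (hS : IsBoundedC1 S b) (hR : IsBoundedC1 R b)
    (h : IsCharCoords (fun z => k (V ((S z.1 - R z.2) / 2))) L α β αx βx) :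
    IsSystemSolution k (fun x => V ((S x - R x) / 2)) (fun x => (S x + R x) / 2) b (L / 4)
      (fun z => V ((S (α z) - R (β z)) / 2)) (fun z => (S (α z) + R (β z)) / 2)
      (fun z => (deriv S (α z) * αx z + deriv R (β z) * βx z) / 2)
      (fun z => (deriv S (α z) * αx z - deriv R (β z) * βx z) / 2) := by
  have hVc : Continuous V :=
    continuous_iff_continuousAt.2 fun z => (hF.hasDerivAt_inv z).continuousAt
  have hSc := hS.continuous
  have hRc := hR.continuous
  have hSc' := hS.continuous_deriv
  have hRc' := hR.continuous_deriv
  obtain ⟨hα, hβ, hαx, hβx, abs_αx, abs_βx, α₀, β₀, dα, dβ, dα_t, dβ_t⟩ := h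
  have k_ne (θ : ℝ) : k θ ≠ 0 := ne_of_gt (by linarith [(mem_Icc_of_abs_sub_one_le (hk1 θ)).1])
  have abs_Sx (z : ℝ × ℝ) : |deriv S (α z) * αx z| ≤ b * 2 := by
    rw [abs_mul]
    exact mul_le_mul (hS.abs_deriv_le _) (abs_αx z) (abs_nonneg _) hS.nonneg
  have abs_Rx (z : ℝ × ℝ) : |deriv R (β z) * βx z| ≤ b * 2 := by
    rw [abs_mul]
    exact mul_le_mul (hR.abs_deriv_le _) (abs_βx z) (abs_nonneg _) hR.nonneg
  refine ⟨by fun_prop, by fun_prop, by fun_prop, by fun_prop,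
    fun z => hF.abs_inv_half_sub_le hS hR _ _, fun z => ?_, fun z => ?_, fun z => ?_,
    fun x => by simp only [α₀, β₀], fun x => by simp only [α₀, β₀], fun t x ht => ?_,
    fun t x ht => ?_, fun t x ht => ?_, fun t x ht => ?_⟩
  · rw [abs_div, abs_two]
    linarith [abs_add_le (S (α z)) (R (β z)), hS.abs_le (α z), hR.abs_le (β z)]
  · rw [abs_div, abs_two]
    linarith [abs_add_le (deriv S (α z) * αx z) (deriv R (β z) * βx z), abs_Sx z, abs_Rx z]
  · rw [abs_div, abs_two]
    linarith [abs_sub (deriv S (α z) * αx z) (deriv R (β z) * βx z), abs_Sx z, abs_Rx z]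
  · refine ((hF.hasDerivAt_inv _).comp t ((((hS.hasDerivAt _).comp t (dα_t t x ht)).sub
      ((hR.hasDerivAt _).comp t (dβ_t t x ht))).div_const 2)).congr_deriv ?_
    have := k_ne (V ((S (α (t, x)) - R (β (t, x))) / 2))
    simp only [Function.comp_apply, Pi.sub_apply]
    field_simp
    ring
  · refine ((((hS.hasDerivAt _).comp t (dα_t t x ht)).add
      ((hR.hasDerivAt _).comp t (dβ_t t x ht))).div_const 2).congr_deriv ?_
    ring
  · exact (hF.hasDerivAt_inv _).comp x ((((hS.hasDerivAt _).comp x (dα t x ht)).sub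
      ((hR.hasDerivAt _).comp x (dβ t x ht))).div_const 2)
  · exact (((hS.hasDerivAt _).comp x (dα t x ht)).add
      ((hR.hasDerivAt _).comp x (dβ t x ht))).div_const 2

theorem exists_isSystemSolution (hk : ContDiff ℝ 1 k) (hk1 : ∀ θ, |k θ - 1| ≤ 1 / 100)
    (hf : IsBoundedC1 f m) (hg : IsBoundedC1 g m) (hm : m ≤ 1 / 3) (hL : 0 < L)
    (hηL : η * L ≤ 1 / 200) (hη : ∀ θ, |θ| ≤ 6 * m → |deriv k θ| ≤ η) :
    ∃ v w X Y, IsSystemSolution k f g (3 * m) (L / 4) v w X Y := by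
  obtain ⟨F, V, hF⟩ := exists_isSpeedPrimitive hk.continuous hk1
  have hFf := hf.speedPrimitive_comp hk.continuous hk1 hF
  have hS : IsBoundedC1 (fun x => g x + F (f x)) (3 * m) := (hg.add hFf).mono (by linarith)
  have hR : IsBoundedC1 (fun x => g x + -F (f x)) (3 * m) := (hg.add hFf.neg).mono (by linarith)
  obtain ⟨α, β, αx, βx, h⟩ := (hF.isSlowSpeed hk hk1 hS hR (by linarith)
    fun θ hθ => hη θ (by linarith)).exists_isCharCoords hL hηL
  have v_eq (x : ℝ) : V ((g x + F (f x) - (g x + -F (f x))) / 2) = f x := by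
    ring_nf
    exact hF.leftInverse _
  have w_eq (x : ℝ) : (g x + F (f x) + (g x + -F (f x))) / 2 = g x := by ring
  exact ⟨_, _, _, _, by simpa only [v_eq, w_eq] using h.isSystemSolution hF hk1 hS hR⟩

namespace IsSystemSolution

variable {v w X Y : ℝ × ℝ → ℝ}

theorem hasDerivAt_potential (h : IsSystemSolution k (deriv f) g b T v w X Y)
    (hf : Differentiable ℝ f) {t : ℝ} (ht : t ∈ Ico 0 T) (x : ℝ) :
    HasDerivAt (fun y => f y + ∫ r in (0 : ℝ)..t, w (r, y)) (v (t, x)) x := by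
  have hX := h.continuous_X
  have inside {r : ℝ} (hr : r ∈ uIcc 0 t) : |r| < T := by
    rw [uIcc_of_le ht.1] at hr
    rw [abs_of_nonneg hr.1]
    exact hr.2.trans_lt ht.2
  have deriv_integral := hasDerivAt_intervalIntegral_param h.continuous_w hX (b₀ := x) one_pos
    fun r hr y _ => h.deriv_w_x r y (inside hr)
  have integral_X : ∫ r in (0 : ℝ)..t, X (r, x) = v (t, x) - v (0, x) :=
    intervalIntegral.integral_eq_sub_of_hasDerivAt (fun r hr => h.deriv_v_t r x (inside hr))
      ((by fun_prop : Continuous fun r => X (r, x)).intervalIntegrable _ _)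
  refine ((hf x).hasDerivAt.add deriv_integral).congr_deriv ?_
  rw [integral_X, h.initial_v, add_sub_cancel]

theorem isClassicalSolution (h : IsSystemSolution k (deriv f) g b T v w X Y)
    (hf : Differentiable ℝ f) (hk : Continuous k) (k_ne : ∀ θ, k θ ≠ 0) {c : ℝ → ℝ} {U : Set ℝ}
    (hU : ∀ θ, |θ| ≤ 2 * b → θ ∈ U ∧ c θ = k θ) :
    IsClassicalSolution c U f g T (fun t x => f x + ∫ r in (0 : ℝ)..t, w (r, x))
      (fun t x => w (t, x)) (fun t x => v (t, x)) (fun t x => k (v (t, x)) * Y (t, x))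
      (fun t x => X (t, x)) (fun t x => (k (v (t, x)))⁻¹ * Y (t, x)) := by
  have hv := h.continuous_v
  have hw := h.continuous_w
  have hY := h.continuous_Y
  have hfc := hf.continuous
  have hu : Continuous fun p : ℝ × ℝ => f p.2 + ∫ r in (0 : ℝ)..p.1, w (r, p.2) :=
    (hfc.comp continuous_snd).add
      (intervalIntegral.continuous_parametric_intervalIntegral_of_continuous
        (f := fun (p : ℝ × ℝ) r => w (r, p.2)) (by unfold Function.uncurry; fun_prop)
        continuous_fst)
  have inside {t : ℝ} (ht : t ∈ Ico 0 T) : |t| < T := (abs_of_nonneg ht.1).trans_lt ht.2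
  exact {
    cont_u := hu.continuousOn
    cont_ut := hw.continuousOn
    cont_ux := hv.continuousOn
    cont_utt := ((hk.comp hv).mul hY).continuousOn
    cont_utx := h.continuous_X.continuousOn
    cont_uxx := (((hk.comp hv).inv₀ fun _ => k_ne _).mul hY).continuousOn
    deriv_t := fun t _ x => (((by fun_prop : Continuous fun r => w (r, x)).integral_hasStrictDerivAt
      0 t).hasDerivAt.const_add (f x)).hasDerivWithinAt
    deriv_x := fun t ht x => h.hasDerivAt_potential hf ht x
    deriv_tt := fun t ht x => (h.deriv_w_t t x (inside ht)).hasDerivWithinAt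
    deriv_tx := fun t ht x => h.deriv_w_x t x (inside ht)
    deriv_xt := fun t ht x => (h.deriv_v_t t x (inside ht)).hasDerivWithinAt
    deriv_xx := fun t ht x => h.deriv_v_x t x (inside ht)
    mem_domain := fun t _ x => (hU _ (h.abs_v_le _)).1
    equation := fun t _ x => by
      have := k_ne (v (t, x))
      rw [(hU _ (h.abs_v_le (t, x))).2]
      field_simp
      ring
    initial_u := fun x => by simp
    initial_ut := h.initial_w }

theorem hasBoundedSolution (h : IsSystemSolution k (deriv f) g b T v w X Y)
    (hf : IsBoundedC1 f m) (hk : Continuous k) (hk1 : ∀ θ, |k θ - 1| ≤ 1 / 100) {c : ℝ → ℝ}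
    {U : Set ℝ} (hU : ∀ θ, |θ| ≤ 2 * b → θ ∈ U ∧ c θ = k θ) : HasBoundedSolution c U f g T := by
  have k_mem (θ : ℝ) := mem_Icc_of_abs_sub_one_le (hk1 θ)
  have k_ne (θ : ℝ) : k θ ≠ 0 := ne_of_gt (by linarith [(k_mem θ).1])
  have b_nonneg : 0 ≤ b := (abs_nonneg _).trans (h.abs_w_le 0)
  have m_nonneg := hf.nonneg
  refine ⟨_, _, _, _, _, _, h.isClassicalSolution (hf.contDiff.differentiable one_ne_zero) hk k_ne
    hU, m + b * T + 4 * b + 2, fun t ht x => ?_⟩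
  have bT_nonneg : 0 ≤ b * T := mul_nonneg b_nonneg (ht.1.trans ht.2.le)
  have abs_v := h.abs_v_le (t, x)
  have abs_integral : |∫ r in (0 : ℝ)..t, w (r, x)| ≤ b * T := by
    refine (intervalIntegral.norm_integral_le_of_norm_le_const (f := fun r => w (r, x))
      fun r _ => h.abs_w_le _).trans ?_
    rw [sub_zero, abs_of_nonneg ht.1]
    exact mul_le_mul_of_nonneg_left ht.2.le b_nonneg
  have abs_mul_Y {y : ℝ} (hy : |y| ≤ 2) : |y * Y (t, x)| ≤ 2 * (2 * b) := by
    rw [abs_mul]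
    exact mul_le_mul hy (h.abs_Y_le _) (abs_nonneg _) two_pos.le
  have abs_kv : |k (v (t, x))| ≤ 2 :=
    abs_le.2 ⟨by linarith [(k_mem (v (t, x))).1], by linarith [(k_mem (v (t, x))).2]⟩
  have abs_inv := abs_inv_le_two (hk1 (v (t, x)))
  refine ⟨(abs_add_le _ _).trans (by linarith [hf.abs_le x]), by linarith [h.abs_w_le (t, x)],
    by linarith, by linarith [abs_mul_Y abs_kv], by linarith [h.abs_X_le (t, x)],
    by linarith [abs_mul_Y abs_inv], ?_, ?_⟩ <;> rw [(hU _ abs_v).2]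
  · exact k_ne _
  · linarith

end IsSystemSolution

theorem hasBoundedSolution_of_slow_speed (hk : ContDiff ℝ 1 k) (hk1 : ∀ θ, |k θ - 1| ≤ 1 / 100)
    (hf : IsBoundedC1 f m) (hf' : IsBoundedC1 (deriv f) m) (hg : IsBoundedC1 g m)
    (hm : m ≤ 1 / 3) (hL : 0 < L) (hηL : η * L ≤ 1 / 200)
    (hη : ∀ θ, |θ| ≤ 6 * m → |deriv k θ| ≤ η) {c : ℝ → ℝ} {U : Set ℝ}
    (hU : ∀ θ, |θ| ≤ 6 * m → θ ∈ U ∧ c θ = k θ) : HasBoundedSolution c U f g (L / 4) := by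
  obtain ⟨v, w, X, Y, h⟩ := exists_isSystemSolution hk hk1 hf' hg hm hL hηL hη
  exact h.hasBoundedSolution hf hk.continuous hk1 fun θ hθ => hU θ (by linarith)

end SlowWave

/-! ### Flat Gevrey functions and the lower bound -/

section Gevrey

variable {s p δ : ℝ} {U : Set ℝ} {c : ℝ → ℝ}

theorem hasDerivAt_iteratedDeriv_of_contDiffOn (hU : IsOpen U) (hc : ContDiffOn ℝ ∞ c U) (m : ℕ)
    {θ : ℝ} (hθ : θ ∈ U) : HasDerivAt (iteratedDeriv m c) (iteratedDeriv (m + 1) c θ) θ := by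
  have diff_within := hc.differentiableOn_iteratedDerivWithin (m := m)
    (by exact_mod_cast ENat.natCast_lt_top m) hU.uniqueDiffOn
  have diff : DifferentiableAt ℝ (iteratedDeriv m c) θ :=
    ((diff_within θ hθ).differentiableAt (hU.mem_nhds hθ)).congr_of_eventuallyEq
      ((iteratedDerivWithin_of_isOpen hU).symm.eventuallyEq_of_mem (hU.mem_nhds hθ))
  rw [iteratedDeriv_succ]
  exact diff.hasDerivAt

theorem abs_le_pow_succ_of_abs_deriv_le {f f' : ℝ → ℝ} {θ B : ℝ} {j : ℕ}
    (hf : ∀ y, |y| ≤ |θ| → HasDerivAt f (f' y) y) (hf0 : f 0 = 0)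
    (hf' : ∀ y, |y| ≤ |θ| → |f' y| ≤ B * |y| ^ j / j.factorial) :
    |f θ| ≤ B * |θ| ^ (j + 1) / (j + 1).factorial := by
  have segment (t : ℝ) (ht : t ∈ Icc (0 : ℝ) 1) : |t * θ| ≤ |θ| := by
    rw [abs_mul, abs_of_nonneg ht.1]
    exact mul_le_of_le_one_left (abs_nonneg θ) ht.2
  have hder (t : ℝ) (ht : t ∈ Icc (0 : ℝ) 1) :
      HasDerivAt (fun t => f (t * θ)) (f' (t * θ) * θ) t :=
    (hf _ (segment t ht)).comp t (hasDerivAt_mul_const θ)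
  have hbound (t : ℝ) : HasDerivAt (fun t => B * |θ| ^ (j + 1) / (j + 1).factorial * t ^ (j + 1))
      (B * |θ| ^ (j + 1) / j.factorial * t ^ j) t := by
    refine ((hasDerivAt_pow (j + 1) t).const_mul _).congr_deriv ?_
    rw [Nat.factorial_succ]
    push_cast
    field_simp
  have comparison := image_norm_le_of_norm_deriv_right_le_deriv_boundary
    (fun t ht => (hder t ht).continuousAt.continuousWithinAt)
    (fun t ht => (hder t (Ico_subset_Icc_self ht)).hasDerivWithinAt) (by simp [hf0]) hbound
    (fun t ht => ?_) (right_mem_Icc.2 zero_le_one)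
  · simpa using comparison
  calc ‖f' (t * θ) * θ‖ = |f' (t * θ)| * |θ| := by rw [Real.norm_eq_abs, abs_mul]
    _ ≤ B * |t * θ| ^ j / j.factorial * |θ| := by
      gcongr
      exact hf' _ (segment t (Ico_subset_Icc_self ht))
    _ = B * |θ| ^ (j + 1) / j.factorial * t ^ j := by
      rw [abs_mul, abs_of_nonneg ht.1]
      ring

theorem abs_le_taylor_of_flat {F : ℕ → ℝ → ℝ} {B : ℝ} {n : ℕ}
    (hF : ∀ m θ, |θ| ≤ δ → HasDerivAt (F m) (F (m + 1) θ) θ) (hF0 : ∀ m, 1 ≤ m → F m 0 = 0)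
    (hB : ∀ θ, |θ| ≤ δ → |F n θ| ≤ B) {j i : ℕ} (hi : 1 ≤ i) (hij : i + j = n) {θ : ℝ}
    (hθ : |θ| ≤ δ) : |F i θ| ≤ B * |θ| ^ j / j.factorial := by
  induction j generalizing i θ with
  | zero =>
    obtain rfl : i = n := by simpa using hij
    simpa using hB θ hθ
  | succ j ih =>
    exact abs_le_pow_succ_of_abs_deriv_le (fun y hy => hF i y (hy.trans hθ)) (hF0 i hi)
      fun y hy => ih (by omega) (by omega) (hy.trans hθ)

theorem factorial_succ_rpow_le (hs : 1 ≤ s) (m : ℕ) :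
    ((m + 1).factorial : ℝ) ^ s ≤ (2 ^ s * (m : ℝ) ^ (s - 1)) ^ m * m.factorial := by
  have rpow_comm (a : ℝ) (ha : 0 ≤ a) (r : ℝ) : (a ^ m) ^ r = (a ^ r) ^ m := by
    rw [← Real.rpow_natCast, ← Real.rpow_natCast, ← Real.rpow_mul ha, ← Real.rpow_mul ha, mul_comm]
  have fac_pos : (0 : ℝ) < m.factorial := by positivity
  have succ_le : (m : ℝ) + 1 ≤ 2 ^ m := by exact_mod_cast Nat.lt_two_pow_self (n := m)
  have fac_le : (m.factorial : ℝ) ≤ (m : ℝ) ^ m := by exact_mod_cast Nat.factorial_le_pow m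
  calc ((m + 1).factorial : ℝ) ^ s = ((m : ℝ) + 1) ^ s * (m.factorial : ℝ) ^ s := by
        rw [Nat.factorial_succ, Nat.cast_mul, Nat.cast_succ,
          Real.mul_rpow (by positivity) fac_pos.le]
    _ = ((m : ℝ) + 1) ^ s * (m.factorial : ℝ) ^ (s - 1) * m.factorial := by
        rw [mul_assoc, ← Real.rpow_add_one fac_pos.ne', sub_add_cancel]
    _ ≤ (2 ^ m) ^ s * ((m : ℝ) ^ m) ^ (s - 1) * m.factorial := by gcongr
    _ = (2 ^ s * (m : ℝ) ^ (s - 1)) ^ m * m.factorial := by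
        rw [rpow_comm 2 two_pos.le, rpow_comm m m.cast_nonneg, mul_pow]

theorem MemGevrey.abs_deriv_le_pow (hs : 1 ≤ s) (hU : IsOpen U) (hδU : ∀ θ, |θ| ≤ δ → θ ∈ U)
    (hc : MemGevrey s U c) (hflat : ∀ m : ℕ, 1 ≤ m → iteratedDeriv m c 0 = 0) :
    ∃ B > 0, ∃ D > 0, ∀ (m : ℕ) (θ : ℝ), |θ| ≤ δ →
      |deriv c θ| ≤ B * (D * |θ| * (m : ℝ) ^ (s - 1)) ^ m := by
  obtain ⟨smooth, C, hC, A, hA, hCA⟩ := hc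
  refine ⟨C * A, by positivity, A * 2 ^ s, by positivity, fun m θ hθ => ?_⟩
  have taylor := abs_le_taylor_of_flat (F := fun m => iteratedDeriv m c)
    (fun m θ hθ => hasDerivAt_iteratedDeriv_of_contDiffOn hU smooth m (hδU θ hθ)) hflat
    (fun θ hθ => hCA (m + 1) θ (hδU θ hθ)) le_rfl (add_comm 1 m) hθ
  rw [iteratedDeriv_one] at taylor
  calc |deriv c θ|
      ≤ C * A ^ (m + 1) * ((m + 1).factorial : ℝ) ^ s * |θ| ^ m / m.factorial := taylor
    _ ≤ C * A ^ (m + 1) * ((2 ^ s * (m : ℝ) ^ (s - 1)) ^ m * m.factorial) * |θ| ^ m /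
          m.factorial := by gcongr; exact factorial_succ_rpow_le hs m
    _ = C * A * (A * 2 ^ s * |θ| * (m : ℝ) ^ (s - 1)) ^ m := by
        field_simp
        ring

-- The choice `m = ⌊X⌋` with `D a X ^ p = e⁻¹` is optimal up to constants.
theorem le_exp_of_forall_le_pow {y a B D : ℝ} (hp : 0 < p) (ha : 0 < a) (hB : 0 ≤ B) (hD : 0 < D)
    (hy : ∀ m : ℕ, y ≤ B * (D * a * (m : ℝ) ^ p) ^ m) :
    y ≤ B * Real.exp 1 *
      Real.exp (-((Real.exp 1 * D) ^ (-(1 / p))) * a ^ (-(1 / p))) := by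
  set X := (Real.exp 1 * D) ^ (-(1 / p)) * a ^ (-(1 / p)) with hX
  have X_rpow : D * a * X ^ p = Real.exp (-1) := by
    rw [hX, ← Real.mul_rpow (by positivity) ha.le, ← Real.rpow_mul (by positivity),
      show -(1 / p) * p = -1 by field_simp, Real.rpow_neg_one, Real.exp_neg]
    field_simp
  have base_le : D * a * (⌊X⌋₊ : ℝ) ^ p ≤ Real.exp (-1) := by
    rw [← X_rpow]
    gcongr
    exact Nat.floor_le (by positivity)
  calc y ≤ B * (D * a * (⌊X⌋₊ : ℝ) ^ p) ^ ⌊X⌋₊ := hy _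
    _ ≤ B * Real.exp (-1) ^ ⌊X⌋₊ := by gcongr
    _ ≤ B * (Real.exp 1 * Real.exp (-X)) := by
        rw [← Real.exp_nat_mul, ← Real.exp_add]
        gcongr
        linarith [Nat.lt_floor_add_one X]
    _ = B * Real.exp 1 * Real.exp (-((Real.exp 1 * D) ^ (-(1 / p))) * a ^ (-(1 / p))) := by
        rw [neg_mul, ← hX, mul_assoc]

theorem MemGevrey.abs_deriv_le_exp (hs : 1 < s) (hU : IsOpen U) (hU0 : (0 : ℝ) ∈ U)
    (hc : MemGevrey s U c) (hflat : ∀ m : ℕ, 1 ≤ m → iteratedDeriv m c 0 = 0) :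
    ∃ K > 0, ∃ κ > 0, ∀ᶠ θ in 𝓝[≠] (0 : ℝ),
      |deriv c θ| ≤ K * Real.exp (-κ * |θ| ^ (-(1 / (s - 1)))) := by
  obtain ⟨δ, hδ, hδU⟩ := Metric.nhds_basis_closedBall.mem_iff.1 (hU.mem_nhds hU0)
  obtain ⟨B, hB, D, hD, hBD⟩ :=
    hc.abs_deriv_le_pow hs.le hU (fun θ hθ => hδU (by simpa using hθ)) hflat
  refine ⟨B * Real.exp 1, by positivity, (Real.exp 1 * D) ^ (-(1 / (s - 1))), by positivity, ?_⟩
  filter_upwards [self_mem_nhdsWithin,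
    mem_nhdsWithin_of_mem_nhds (Metric.closedBall_mem_nhds (0 : ℝ) hδ)] with θ hθ0 hθ
  exact le_exp_of_forall_le_pow (sub_pos.2 hs) (abs_pos.2 hθ0) hB.le hD
    fun m => hBD m θ (by simpa using hθ)

theorem exists_contDiff_eventuallyEq_near_one {n : ℕ∞} (hU : IsOpen U) (hU0 : (0 : ℝ) ∈ U)
    (hc : ContDiffOn ℝ n c U) (hc0 : c 0 = 1) :
    ∃ k : ℝ → ℝ, ContDiff ℝ n k ∧ HasCompactSupport (fun θ => k θ - 1) ∧
      (∀ θ, |k θ - 1| ≤ 1 / 100) ∧ ∀ᶠ θ in 𝓝 0, k θ = c θ := by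
  have near : {θ | |c θ - 1| < 1 / 100} ∈ 𝓝 0 := by
    have := (hc.continuousOn.continuousAt (hU.mem_nhds hU0)).sub_const 1 |>.abs
    exact this.eventually_lt continuousAt_const (by simp [hc0])
  obtain ⟨r, hr, hrU⟩ := Metric.nhds_basis_closedBall.mem_iff.1
    (inter_mem (hU.mem_nhds hU0) near)
  let χ : ContDiffBump (0 : ℝ) := ⟨r / 2, r, by positivity, by linarith⟩
  have support : HasCompactSupport fun θ => χ θ * (c θ - 1) := χ.hasCompactSupport.mul_right
  refine ⟨fun θ => 1 + χ θ * (c θ - 1), ?_, by simpa using support, fun θ => ?_, ?_⟩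
  · refine contDiff_const.add (contDiff_iff_contDiffAt.2 fun θ => ?_)
    by_cases hθ : θ ∈ Metric.closedBall (0 : ℝ) r
    · exact χ.contDiff.contDiffAt.mul
        ((hc.contDiffAt (hU.mem_nhds (hrU hθ).1)).sub contDiffAt_const)
    · refine contDiffAt_const (c := (0 : ℝ)) |>.congr_of_eventuallyEq ?_
      filter_upwards [Metric.isClosed_closedBall.isOpen_compl.mem_nhds hθ] with y hy
      rw [χ.zero_of_le_dist (not_le.1 (mt Metric.mem_closedBall.2 hy)).le, zero_mul]
  · rw [add_sub_cancel_left, abs_mul, abs_of_nonneg χ.nonneg]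
    by_cases hθ : θ ∈ Metric.closedBall (0 : ℝ) r
    · exact (mul_le_of_le_one_left (abs_nonneg _) χ.le_one).trans (hrU hθ).2.le
    · rw [χ.zero_of_le_dist (not_le.1 (mt Metric.mem_closedBall.2 hθ)).le, zero_mul]
      norm_num
  · filter_upwards [χ.eventuallyEq_one] with θ hθ
    rw [hθ, Pi.one_apply]
    ring

end Gevrey

section LowerBound

variable {f φ ψ : ℝ → ℝ} {n : ℕ}

theorem MemCb.deriv (hf : MemCb (n + 1) f) : MemCb n (deriv f) := by
  refine ⟨(contDiff_succ_iff_deriv.1 (by exact_mod_cast hf.1)).2.2, fun k hk => ?_⟩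
  simpa only [← iteratedDeriv_succ'] using hf.2 (k + 1) (by omega)

theorem MemCb.exists_isBoundedC1 (hf : MemCb (n + 1) f) : ∃ M, IsBoundedC1 f M := by
  obtain ⟨M₀, h₀⟩ := hf.2 0 (by omega)
  obtain ⟨M₁, h₁⟩ := hf.2 1 (by omega)
  exact ⟨max M₀ M₁, hf.1.of_le (by exact_mod_cast Nat.le_add_left 1 n),
    fun x => le_max_of_le_left (by simpa using h₀ x),
    fun x => le_max_of_le_right (by simpa using h₁ x)⟩

theorem exists_isBoundedC1_data (hφ : MemCb 2 φ) (hψ : MemCb 1 ψ) :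
    ∃ M > 0, IsBoundedC1 φ M ∧ IsBoundedC1 (deriv φ) M ∧ IsBoundedC1 ψ M := by
  obtain ⟨M₀, h₀⟩ := hφ.exists_isBoundedC1
  obtain ⟨M₁, h₁⟩ := hφ.deriv.exists_isBoundedC1
  obtain ⟨M₂, h₂⟩ := hψ.exists_isBoundedC1
  exact ⟨max 1 (max M₀ (max M₁ M₂)), by positivity, h₀.mono (by simp), h₁.mono (by simp),
    h₂.mono (by simp)⟩

theorem IsBoundedC1.const_mul_deriv {M ε : ℝ} (hf : IsBoundedC1 (deriv f) M)
    (hε : 0 ≤ ε) : IsBoundedC1 (deriv fun x => ε * f x) (ε * M) := by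
  simpa only [deriv_const_mul_field'] using hf.const_mul hε

theorem eventually_forall_abs_le {P : ℝ → Prop} (hP : ∀ᶠ θ in 𝓝 0, P θ) :
    ∀ᶠ r in 𝓝 0, ∀ θ, |θ| ≤ r → P θ := by
  obtain ⟨δ, hδ, hδP⟩ := Metric.eventually_nhds_iff.1 hP
  filter_upwards [gt_mem_nhds hδ] with r hr θ hθ
  exact hδP (by simpa using hθ.trans_lt hr)

theorem MemGevrey.eventually_forall_abs_deriv_le {s : ℝ} (hs : 1 < s) {U : Set ℝ} (hU : IsOpen U)
    (hU0 : (0 : ℝ) ∈ U) {c : ℝ → ℝ} (hc : MemGevrey s U c)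
    (hflat : ∀ m : ℕ, 1 ≤ m → iteratedDeriv m c 0 = 0) :
    ∃ K > 0, ∃ κ > 0, ∀ᶠ r in 𝓝 (0 : ℝ), ∀ θ, |θ| ≤ r →
      |deriv c θ| ≤ K * Real.exp (-κ * r ^ (-(1 / (s - 1)))) := by
  obtain ⟨K, hK, κ, hκ, hflat_exp⟩ := hc.abs_deriv_le_exp hs hU hU0 hflat
  refine ⟨K, hK, κ, hκ, ?_⟩
  filter_upwards [eventually_forall_abs_le (eventually_nhdsWithin_iff.1 hflat_exp)] with r hr θ hθ
  rcases eq_or_ne θ 0 with rfl | hθ0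
  · rw [← iteratedDeriv_one, hflat 1 le_rfl, abs_zero]
    positivity
  have anti : r ^ (-(1 / (s - 1))) ≤ |θ| ^ (-(1 / (s - 1))) :=
    Real.rpow_le_rpow_of_nonpos (abs_pos.2 hθ0) hθ
      (neg_nonpos.2 (one_div_pos.2 (sub_pos.2 hs)).le)
  refine (hr θ hθ hθ0).trans ?_
  rw [neg_mul, neg_mul]
  gcongr

theorem le_lifespan {s : ℝ} (hs : 1 < s) {U : Set ℝ} (hU : IsOpen U) (hU0 : (0 : ℝ) ∈ U)
    {c : ℝ → ℝ} (hc : MemGevrey s U c) (hc0 : c 0 = 1)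
    (hflat : ∀ m : ℕ, 1 ≤ m → iteratedDeriv m c 0 = 0)
    (hφ : MemCb 2 φ) (hψ : MemCb 1 ψ) :
    ∃ C₁ > (0 : ℝ), ∃ C₂ > (0 : ℝ), ∀ᶠ ε in 𝓝[>] (0 : ℝ),
      ENNReal.ofReal (C₁ * Real.exp (C₂ * ε ^ (-(1 / (s - 1))))) ≤
        lifespan c U (fun x => ε * φ x) (fun x => ε * ψ x) := by
  obtain ⟨K, hK, κ, hκ, flat⟩ := hc.eventually_forall_abs_deriv_le hs hU hU0 hflat
  obtain ⟨k, hk, -, hk1, hkc⟩ := exists_contDiff_eventuallyEq_near_one (n := 1) hU hU0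
    (hc.1.of_le (by exact_mod_cast le_top)) hc0
  obtain ⟨M, hM, hφM, hφM', hψM⟩ := exists_isBoundedC1_data hφ hψ
  refine ⟨1 / (800 * K), by positivity, κ * (6 * M) ^ (-(1 / (s - 1))), by positivity, ?_⟩
  have radius_tendsto : Tendsto (fun ε => 6 * (ε * M)) (𝓝[>] 0) (𝓝 0) :=
    tendsto_nhdsWithin_of_tendsto_nhds (Continuous.tendsto' (by fun_prop) _ _ (by simp))
  filter_upwards [self_mem_nhdsWithin, radius_tendsto.eventually flat,
    radius_tendsto.eventually (gt_mem_nhds two_pos), radius_tendsto.eventually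
      (eventually_forall_abs_le ((hU.eventually_mem hU0).and hkc.eventually_nhds))]
    with ε (hε : 0 < ε) deriv_le small agree
  set η := K * Real.exp (-κ * (6 * (ε * M)) ^ (-(1 / (s - 1)))) with hη
  have solution := hasBoundedSolution_of_slow_speed (c := c) (U := U) (η := η)
    (L := 1 / (200 * η)) hk hk1 (hφM.const_mul hε.le) (hφM'.const_mul_deriv hε.le)
    (hψM.const_mul hε.le) (by linarith) (by positivity) (by rw [hη]; field_simp; exact le_rfl)
    (fun θ hθ => by
      rw [EventuallyEq.deriv_eq (agree θ hθ).2]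
      exact deriv_le θ hθ)
    (fun θ hθ => ⟨(agree θ hθ).1, (agree θ hθ).2.self_of_nhds.symm⟩)
  refine le_sSup ⟨1 / (200 * η) / 4, by positivity, solution, ?_⟩
  rw [hη, neg_mul, Real.exp_neg, show 6 * (ε * M) = 6 * M * ε by ring,
    Real.mul_rpow (by positivity) hε.le]
  congr 1
  field_simp
  norm_num

end LowerBound

/-! ### Steepening along characteristics -/

/-- A bounded `C¹` solution of `v_t = w_x`, `w_t = k(v)² v_x` on `[0, τ] × ℝ`, continuously
extended to all times. -/
structure IsSlabSolution (k : ℝ → ℝ) (τ : ℝ) (M : ℝ≥0) (v w vx wx : ℝ × ℝ → ℝ) : Prop where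
  cont_v : Continuous v
  cont_w : Continuous w
  cont_vx : Continuous vx
  cont_wx : Continuous wx
  bound_vx : ∀ p, |vx p| ≤ M
  bound_wx : ∀ p, |wx p| ≤ M
  deriv_v : ∀ t x, HasDerivAt (fun y => v (t, y)) (vx (t, x)) x
  deriv_w : ∀ t x, HasDerivAt (fun y => w (t, y)) (wx (t, x)) x
  deriv_vt : ∀ t ∈ Ioo 0 τ, ∀ x, HasDerivAt (fun s => v (s, x)) (wx (t, x)) t
  deriv_wt : ∀ t ∈ Ioo 0 τ, ∀ x, HasDerivAt (fun s => w (s, x)) (k (v (t, x)) ^ 2 * vx (t, x)) t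

/-- A `C¹` wave speed on `ℝ` that is Lipschitz and uniformly close to `1`. -/
structure IsNearUnitSpeed (k : ℝ → ℝ) (K : ℝ≥0) : Prop where
  contDiff : ContDiff ℝ 1 k
  lipschitz : LipschitzWith K k
  abs_sub_one_le : ∀ θ, |k θ - 1| ≤ 1 / 100

/-- `X` is a characteristic curve of the family along which the Riemann invariant
`w + σ F(v)`, `σ = ±1`, is transported. -/
structure IsCharacteristic (k : ℝ → ℝ) (v : ℝ × ℝ → ℝ) (τ σ : ℝ) (X : ℝ → ℝ) : Prop where
  continuous : Continuous X
  hasDerivAt : ∀ t ∈ Ioo 0 τ, HasDerivAt X (-(σ * k (v (t, X t)))) t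

/-- The `x`-derivative of the Riemann invariant `w + F(v)`. -/
def invariantDeriv (k : ℝ → ℝ) (v vx wx : ℝ × ℝ → ℝ) (p : ℝ × ℝ) : ℝ :=
  wx p + k (v p) * vx p

section Characteristics

variable {k F V X : ℝ → ℝ} {τ σ m t X' : ℝ} {K M : ℝ≥0} {v w vx wx : ℝ × ℝ → ℝ}

namespace IsNearUnitSpeed

theorem continuous (hk : IsNearUnitSpeed k K) : Continuous k := hk.contDiff.continuous

theorem hasDerivAt (hk : IsNearUnitSpeed k K) (θ : ℝ) : HasDerivAt k (deriv k θ) θ :=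
  (hk.contDiff.differentiable one_ne_zero θ).hasDerivAt

theorem mem_Icc (hk : IsNearUnitSpeed k K) (θ : ℝ) : k θ ∈ Icc (99 / 100) (101 / 100) :=
  mem_Icc_of_abs_sub_one_le (hk.abs_sub_one_le θ)

theorem pos (hk : IsNearUnitSpeed k K) (θ : ℝ) : 0 < k θ := by linarith [(hk.mem_Icc θ).1]

theorem abs_le_two (hk : IsNearUnitSpeed k K) (θ : ℝ) : |k θ| ≤ 2 := by
  rw [abs_of_pos (hk.pos θ)]
  linarith [(hk.mem_Icc θ).2]

end IsNearUnitSpeed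

-- `-σ (X t - X 0)` is the distance travelled in the direction of motion.
theorem IsCharacteristic.le_displacement (hX : IsCharacteristic k v τ σ X)
    (hk : IsNearUnitSpeed k K) (hσ : σ ^ 2 = 1) (ht : t ∈ Icc 0 τ) :
    99 / 100 * t ≤ -σ * (X t - X 0) := by
  have hd (s : ℝ) (hs : s ∈ interior (Icc 0 τ)) :
      HasDerivAt (fun s => -σ * X s) (k (v (s, X s))) s := by
    rw [interior_Icc] at hs
    refine ((hX.hasDerivAt s hs).const_mul (-σ)).congr_deriv ?_
    linear_combination k (v (s, X s)) * hσ
  have growth := (convex_Icc 0 τ).mul_sub_le_image_sub_of_le_deriv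
    (hX.continuous.const_mul (-σ)).continuousOn
    (fun s hs => (hd s hs).differentiableAt.differentiableWithinAt)
    (fun s hs => by rw [(hd s hs).deriv]; exact (hk.mem_Icc _).1)
    0 (left_mem_Icc.2 (ht.1.trans ht.2)) t ht ht.1
  linarith

namespace IsSlabSolution

theorem lipschitzWith_speed (h : IsSlabSolution k τ M v w vx wx) (hk : IsNearUnitSpeed k K)
    (t : ℝ) : LipschitzWith (K * M) fun x => k (v (t, x)) :=
  hk.lipschitz.comp <| lipschitzWith_of_nnnorm_deriv_le
    (fun x => (h.deriv_v t x).differentiableAt)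
    fun x => by rw [(h.deriv_v t x).deriv]; exact h.bound_vx _

theorem hasDerivAt_v_along (h : IsSlabSolution k τ M v w vx wx) (ht : t ∈ Ioo 0 τ)
    (hX : HasDerivAt X X' t) :
    HasDerivAt (fun s => v (s, X s)) (wx (t, X t) + X' * vx (t, X t)) t := by
  have hd := (hasStrictFDerivAt_of_partials (isOpen_Ioo.prod isOpen_univ) h.cont_wx.continuousOn
    h.cont_vx.continuousOn (fun z hz => h.deriv_vt z.1 hz.1 z.2) (fun z _ => h.deriv_v z.1 z.2)
    (z := (t, X t)) ⟨ht, mem_univ _⟩).hasFDerivAt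
  refine (hd.comp_hasDerivAt t ((hasDerivAt_id t).prodMk hX)).congr_deriv ?_
  simp [mul_comm]

theorem hasDerivAt_w_along (h : IsSlabSolution k τ M v w vx wx) (hk : Continuous k)
    (ht : t ∈ Ioo 0 τ) (hX : HasDerivAt X X' t) :
    HasDerivAt (fun s => w (s, X s)) (k (v (t, X t)) ^ 2 * vx (t, X t) + X' * wx (t, X t)) t := by
  have hd := (hasStrictFDerivAt_of_partials (isOpen_Ioo.prod isOpen_univ)
    (((hk.comp h.cont_v).pow 2).mul h.cont_vx).continuousOn
    h.cont_wx.continuousOn (fun z hz => h.deriv_wt z.1 hz.1 z.2) (fun z _ => h.deriv_w z.1 z.2)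
    (z := (t, X t)) ⟨ht, mem_univ _⟩).hasFDerivAt
  refine (hd.comp_hasDerivAt t ((hasDerivAt_id t).prodMk hX)).congr_deriv ?_
  simp [mul_comm]

theorem hasDerivAt_invariant_along (h : IsSlabSolution k τ M v w vx wx) (hk : Continuous k)
    (hF : ∀ θ, HasDerivAt F (k θ) θ) (σ : ℝ) (ht : t ∈ Ioo 0 τ) (hX : HasDerivAt X X' t) :
    HasDerivAt (fun s => w (s, X s) + σ * F (v (s, X s)))
      (k (v (t, X t)) ^ 2 * vx (t, X t) + X' * wx (t, X t) +
        σ * (k (v (t, X t)) * (wx (t, X t) + X' * vx (t, X t)))) t :=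
  (h.hasDerivAt_w_along hk ht hX).add
    (((hF _).comp t (h.hasDerivAt_v_along ht hX)).const_mul σ)

theorem isPicardLindelof (h : IsSlabSolution k τ M v w vx wx) (hk : IsNearUnitSpeed k K)
    (hσ : |σ| = 1) (t₀ : Icc 0 τ) (x₀ : ℝ) :
    IsPicardLindelof (fun t x => -(σ * k (v (t, x)))) t₀ x₀
      ⟨2 * τ, mul_nonneg two_pos.le (t₀.2.1.trans t₀.2.2)⟩ 0 2 (K * M) where
  lipschitzOnWith t _ := LipschitzOnWith.of_dist_le_mul fun x _ y _ => by
    rw [dist_neg_neg, Real.dist_eq, ← mul_sub, abs_mul, hσ, one_mul, ← Real.dist_eq]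
    exact (h.lipschitzWith_speed hk t).dist_le_mul x y
  continuousOn x _ := by
    have := h.cont_v
    have := hk.continuous
    fun_prop
  norm_le t _ x _ := by
    rw [norm_neg, Real.norm_eq_abs, abs_mul, hσ, one_mul]
    exact hk.abs_le_two _
  mul_max_le := by
    have : max (τ - t₀) t₀ ≤ τ := max_le (sub_le_self _ t₀.2.1) t₀.2.2
    simp only [NNReal.coe_zero, sub_zero, NNReal.coe_ofNat]
    exact mul_le_mul_of_nonneg_left this two_pos.le

theorem exists_isCharacteristic (h : IsSlabSolution k τ M v w vx wx) (hk : IsNearUnitSpeed k K)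
    (hσ : |σ| = 1) (ht : t ∈ Icc 0 τ) (x : ℝ) : ∃ X, IsCharacteristic k v τ σ X ∧ X t = x := by
  have hτ : 0 ≤ τ := ht.1.trans ht.2
  obtain ⟨Y, hYt, hY⟩ :=
    (h.isPicardLindelof hk hσ ⟨t, ht⟩ x).exists_eq_forall_mem_Icc_hasDerivWithinAt₀
  have extend_eq (s : ℝ) (hs : s ∈ Icc 0 τ) : Y (projIcc 0 τ hτ s) = Y s := by
    rw [projIcc_of_mem hτ hs]
  have cont_Y : ContinuousOn Y (Icc 0 τ) := fun s hs => (hY s hs).continuousWithinAt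
  refine ⟨fun s => Y (projIcc 0 τ hτ s), ⟨?_, fun s hs => ?_⟩, (extend_eq t ht).trans hYt⟩
  · exact cont_Y.comp_continuous (by fun_prop) fun s => (projIcc 0 τ hτ s).2
  · have hnhds := Icc_mem_nhds hs.1 hs.2
    rw [extend_eq s (Ioo_subset_Icc_self hs)]
    exact ((hY s (Ioo_subset_Icc_self hs)).hasDerivAt hnhds).congr_of_eventuallyEq
      (eventually_of_mem hnhds extend_eq)

theorem invariant_eq (h : IsSlabSolution k τ M v w vx wx) (hk : Continuous k)
    (hF : ∀ θ, HasDerivAt F (k θ) θ) (hσ : σ ^ 2 = 1) (hX : IsCharacteristic k v τ σ X)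
    (ht : t ∈ Icc 0 τ) :
    w (t, X t) + σ * F (v (t, X t)) = w (0, X 0) + σ * F (v (0, X 0)) := by
  have hFc : Continuous F := continuous_iff_continuousAt.2 fun θ => (hF θ).continuousAt
  have := h.cont_v
  have := h.cont_w
  have := hX.continuous
  have integral_zero := intervalIntegral.integral_eq_sub_of_hasDerivAt_of_le ht.1
    (f := fun s => w (s, X s) + σ * F (v (s, X s))) (f' := fun _ => 0)
    (Continuous.continuousOn (by fun_prop))
    (fun s hs => by
      have hs' : s ∈ Ioo 0 τ := ⟨hs.1, hs.2.trans_le ht.2⟩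
      refine (h.hasDerivAt_invariant_along hk hF σ hs' (hX.hasDerivAt s hs')).congr_deriv ?_
      linear_combination -(k (v (s, X s)) ^ 2 * vx (s, X s)) * hσ)
    intervalIntegrable_const
  rw [intervalIntegral.integral_zero] at integral_zero
  exact (sub_eq_zero.1 integral_zero.symm)

theorem exists_foot (h : IsSlabSolution k τ M v w vx wx) (hk : IsNearUnitSpeed k K)
    (hF : ∀ θ, HasDerivAt F (k θ) θ) (hσ : |σ| = 1) (ht : t ∈ Icc 0 τ) (x : ℝ) :
    ∃ y, 99 / 100 * t ≤ -σ * (x - y) ∧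
      w (t, x) + σ * F (v (t, x)) = w (0, y) + σ * F (v (0, y)) := by
  have hσ' : σ ^ 2 = 1 := by rw [← sq_abs, hσ, one_pow]
  obtain ⟨X, hX, rfl⟩ := h.exists_isCharacteristic hk hσ ht x
  exact ⟨X 0, hX.le_displacement hk hσ' ht, h.invariant_eq hk.continuous hF hσ' hX ht⟩

theorem abs_le_of_data (h : IsSlabSolution k τ M v w vx wx) (hk : IsNearUnitSpeed k K)
    (hv : ∀ x, |v (0, x)| ≤ m) (hw : ∀ x, |w (0, x)| ≤ m) (ht : t ∈ Icc 0 τ) (x : ℝ) :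
    |v (t, x)| ≤ 6 * m := by
  obtain ⟨F, V, hF⟩ := exists_isSpeedPrimitive hk.continuous hk.abs_sub_one_le
  obtain ⟨y, -, hy⟩ := h.exists_foot hk hF.hasDerivAt (σ := 1) (by simp) ht x
  obtain ⟨z, -, hz⟩ := h.exists_foot hk hF.hasDerivAt (σ := -1) (by simp) ht x
  have F_data (y : ℝ) : |F (v (0, y))| ≤ 2 * m := by linarith [hF.abs_le (v (0, y)), hv y]
  have F_le : |F (v (t, x))| ≤ 3 * m := by
    have := abs_le.1 (F_data y)
    have := abs_le.1 (F_data z)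
    have := abs_le.1 (hw y)
    have := abs_le.1 (hw z)
    rw [abs_le]
    constructor <;> linarith
  have := hF.abs_inv_le (F (v (t, x)))
  rw [hF.leftInverse] at this
  linarith

theorem abs_invariantDeriv_le (h : IsSlabSolution k τ M v w vx wx) (hk : IsNearUnitSpeed k K)
    (p : ℝ × ℝ) : |invariantDeriv k v vx wx p| ≤ 3 * M :=
  calc |wx p + k (v p) * vx p| ≤ |wx p| + |k (v p)| * |vx p| := by
        rw [← abs_mul]; exact abs_add_le _ _
    _ ≤ M + 2 * M := by
        gcongr
        exacts [h.bound_wx p, hk.abs_le_two _, h.bound_vx p]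
    _ = 3 * M := by ring

theorem continuous_invariantDeriv (h : IsSlabSolution k τ M v w vx wx) (hk : Continuous k) :
    Continuous (invariantDeriv k v vx wx) :=
  h.cont_wx.add ((hk.comp h.cont_v).mul h.cont_vx)

-- Subtracting the transport equations of the invariant along `X` and along its translate `X + e`
-- avoids second derivatives of the solution.
theorem integral_translate_eq (h : IsSlabSolution k τ M v w vx wx) (hk : IsNearUnitSpeed k K)
    (hF : ∀ θ, HasDerivAt F (k θ) θ) (hX : IsCharacteristic k v τ 1 X) (ht : t ∈ Icc 0 τ) (e : ℝ) :
    ∫ r in (0 : ℝ)..t,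
        (k (v (r, X r + e)) - k (v (r, X r))) * invariantDeriv k v vx wx (r, X r + e) =
      ((w (t, X t + e) + F (v (t, X t + e))) - (w (t, X t) + F (v (t, X t)))) -
      ((w (0, X 0 + e) + F (v (0, X 0 + e))) - (w (0, X 0) + F (v (0, X 0)))) := by
  have := hk.continuous
  have hFc : Continuous F := continuous_iff_continuousAt.2 fun θ => (hF θ).continuousAt
  have := h.cont_v
  have := h.cont_w
  have := hX.continuous
  have := h.continuous_invariantDeriv hk.continuous
  refine intervalIntegral.integral_eq_sub_of_hasDerivAt_of_le ht.1
    (f := fun r => (w (r, X r + e) + F (v (r, X r + e))) - (w (r, X r) + F (v (r, X r))))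
    (Continuous.continuousOn (by fun_prop)) (fun r hr => ?_)
    (Continuous.intervalIntegrable (by fun_prop) _ _)
  have hr' : r ∈ Ioo 0 τ := ⟨hr.1, hr.2.trans_le ht.2⟩
  have hXr := hX.hasDerivAt r hr'
  have translate := h.hasDerivAt_invariant_along hk.continuous hF 1 hr' (hXr.add_const e)
  have base := h.hasDerivAt_invariant_along hk.continuous hF 1 hr' hXr
  simp only [one_mul] at translate base
  refine (translate.sub base).congr_deriv ?_
  rw [invariantDeriv]
  ring

theorem tendsto_integral_translate (h : IsSlabSolution k τ M v w vx wx) (hk : IsNearUnitSpeed k K)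
    (hX : Continuous X) (t : ℝ) :
    Tendsto (fun e => ∫ r in (0 : ℝ)..t, e⁻¹ * ((k (v (r, X r + e)) - k (v (r, X r))) *
      invariantDeriv k v vx wx (r, X r + e))) (𝓝[≠] 0)
      (𝓝 (∫ r in (0 : ℝ)..t, (deriv k (v (r, X r)) * vx (r, X r)) *
        invariantDeriv k v vx wx (r, X r))) := by
  have := hk.continuous
  have := h.cont_v
  have hS := h.continuous_invariantDeriv hk.continuous
  refine intervalIntegral.tendsto_integral_filter_of_dominated_convergence
    (fun _ => (K * M : ℝ≥0) * (3 * M)) ?_ ?_ intervalIntegrable_const ?_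
  · exact Eventually.of_forall fun e => Continuous.aestronglyMeasurable (by fun_prop)
  · filter_upwards [self_mem_nhdsWithin] with e he
    refine Eventually.of_forall fun r _ => ?_
    have lip := (h.lipschitzWith_speed hk r).dist_le_mul (X r + e) (X r)
    rw [Real.dist_eq, Real.dist_eq, add_sub_cancel_left] at lip
    rw [← mul_assoc, Real.norm_eq_abs, abs_mul, abs_mul, abs_inv]
    refine mul_le_mul ?_ (h.abs_invariantDeriv_le hk _) (abs_nonneg _) (by positivity)
    rwa [inv_mul_le_iff₀ (abs_pos.2 he), mul_comm]
  · refine Eventually.of_forall fun r _ => ?_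
    simp only [← mul_assoc]
    have speed_deriv : HasDerivAt (fun y => k (v (r, y))) (deriv k (v (r, X r)) * vx (r, X r))
        (X r) := (hk.hasDerivAt _).comp _ (h.deriv_v r _)
    have cont : Continuous fun e => invariantDeriv k v vx wx (r, X r + e) := by fun_prop
    exact speed_deriv.tendsto_slope_zero.mul
      ((cont.tendsto' 0 _ (by rw [add_zero])).mono_left nhdsWithin_le_nhds)

theorem invariantDeriv_sub_eq_integral (h : IsSlabSolution k τ M v w vx wx)
    (hk : IsNearUnitSpeed k K) (hX : IsCharacteristic k v τ 1 X) (ht : t ∈ Icc 0 τ) :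
    invariantDeriv k v vx wx (t, X t) - invariantDeriv k v vx wx (0, X 0) =
      ∫ r in (0 : ℝ)..t, (deriv k (v (r, X r)) * vx (r, X r)) *
        invariantDeriv k v vx wx (r, X r) := by
  obtain ⟨F, V, hF⟩ := exists_isSpeedPrimitive hk.continuous hk.abs_sub_one_le
  have slope (r : ℝ) : Tendsto (fun e => e⁻¹ * ((w (r, X r + e) + F (v (r, X r + e))) -
      (w (r, X r) + F (v (r, X r))))) (𝓝[≠] 0) (𝓝 (invariantDeriv k v vx wx (r, X r))) :=
    ((h.deriv_w r _).add ((hF.hasDerivAt _).comp (X r) (h.deriv_v r _))).tendsto_slope_zero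
  refine tendsto_nhds_unique ((slope t).sub (slope 0))
    ((h.tendsto_integral_translate hk hX.continuous t).congr fun e => ?_)
  rw [intervalIntegral.integral_const_mul, h.integral_translate_eq hk hF.hasDerivAt hX ht, mul_sub]

theorem hasDerivAt_invariantDeriv_along (h : IsSlabSolution k τ M v w vx wx)
    (hk : IsNearUnitSpeed k K) (hX : IsCharacteristic k v τ 1 X) (ht : t ∈ Ioo 0 τ) :
    HasDerivAt (fun s => invariantDeriv k v vx wx (s, X s))
      ((deriv k (v (t, X t)) * vx (t, X t)) * invariantDeriv k v vx wx (t, X t)) t := by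
  have := hk.contDiff.continuous_deriv_one
  have := h.cont_v
  have := h.cont_vx
  have := hX.continuous
  have := h.continuous_invariantDeriv hk.continuous
  have cont : Continuous fun r => (deriv k (v (r, X r)) * vx (r, X r)) *
    invariantDeriv k v vx wx (r, X r) := by fun_prop
  refine ((cont.integral_hasStrictDerivAt 0 t).hasDerivAt.const_add
    (invariantDeriv k v vx wx (0, X 0))).congr_of_eventuallyEq ?_
  filter_upwards [Icc_mem_nhds ht.1 ht.2] with s hs
  linarith [h.invariantDeriv_sub_eq_integral hk hX hs]

-- The weight `√k` removes the linear term and leaves a pure Riccati equation.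
theorem hasDerivAt_sqrt_mul_invariantDeriv (h : IsSlabSolution k τ M v w vx wx)
    (hk : IsNearUnitSpeed k K) (hX : IsCharacteristic k v τ 1 X) (ht : t ∈ Ioo 0 τ) :
    HasDerivAt (fun s => √(k (v (s, X s))) * invariantDeriv k v vx wx (s, X s))
      (deriv k (v (t, X t)) / (2 * k (v (t, X t)) * √(k (v (t, X t)))) *
        (√(k (v (t, X t))) * invariantDeriv k v vx wx (t, X t)) ^ 2) t := by
  have k_pos : 0 < k (v (t, X t)) := hk.pos _
  have speed_deriv : HasDerivAt (fun s => k (v (s, X s)))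
      (deriv k (v (t, X t)) * (wx (t, X t) + -(1 * k (v (t, X t))) * vx (t, X t))) t :=
    (hk.hasDerivAt _).comp t (h.hasDerivAt_v_along ht (hX.hasDerivAt t ht))
  refine ((speed_deriv.sqrt k_pos.ne').mul
    (h.hasDerivAt_invariantDeriv_along hk hX ht)).congr_deriv ?_
  have sqrt_ne : √(k (v (t, X t))) ≠ 0 := (Real.sqrt_pos.2 k_pos).ne'
  have sqrt_sq : √(k (v (t, X t))) ^ 2 = k (v (t, X t)) := Real.sq_sqrt k_pos.le
  rw [invariantDeriv]
  generalize √(k (v (t, X t))) = q at sqrt_ne sqrt_sq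
  rw [← sqrt_sq]
  field_simp
  ring

end IsSlabSolution

section Riccati

variable {Y A : ℝ → ℝ} {t₀ ϑ : ℝ}

theorem monotoneOn_of_riccati (hYc : ContinuousOn Y (Icc 0 τ))
    (hY : ∀ t ∈ Ioo 0 τ, HasDerivAt Y (A t * Y t ^ 2) t) (hA : ∀ t ∈ Ioo 0 τ, 0 ≤ A t) :
    MonotoneOn Y (Icc 0 τ) := by
  refine monotoneOn_of_deriv_nonneg (convex_Icc 0 τ) hYc ?_ ?_ <;> rw [interior_Icc]
  · exact fun t ht => (hY t ht).differentiableAt.differentiableWithinAt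
  · intro t ht
    rw [(hY t ht).deriv]
    exact mul_nonneg (hA t ht) (sq_nonneg _)

theorem antitoneOn_inv_add_mul_of_riccati (hYc : ContinuousOn Y (Icc t₀ τ))
    (hY : ∀ t ∈ Ioo t₀ τ, HasDerivAt Y (A t * Y t ^ 2) t) (hϑ : ∀ t ∈ Ioo t₀ τ, ϑ ≤ A t)
    (hpos : ∀ t ∈ Icc t₀ τ, 0 < Y t) : AntitoneOn (fun t => (Y t)⁻¹ + ϑ * t) (Icc t₀ τ) := by
  have hd (t : ℝ) (ht : t ∈ Ioo t₀ τ) : HasDerivAt (fun t => (Y t)⁻¹ + ϑ * t) (-A t + ϑ) t := by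
    have Y_ne : Y t ≠ 0 := (hpos t (Ioo_subset_Icc_self ht)).ne'
    refine (((hY t ht).inv Y_ne).add ((hasDerivAt_id t).const_mul ϑ)).congr_deriv ?_
    field_simp
  refine antitoneOn_of_deriv_nonpos (convex_Icc t₀ τ) ?_ ?_ ?_
  · exact (hYc.inv₀ fun t ht => (hpos t ht).ne').add (by fun_prop)
  · rw [interior_Icc]
    exact fun t ht => (hd t ht).differentiableAt.differentiableWithinAt
  · rw [interior_Icc]
    intro t ht
    rw [(hd t ht).deriv]
    linarith [hϑ t ht]

theorem riccati_time_le (ht₀ : t₀ ∈ Icc 0 τ) (hYc : ContinuousOn Y (Icc 0 τ))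
    (hY : ∀ t ∈ Ioo 0 τ, HasDerivAt Y (A t * Y t ^ 2) t) (hA : ∀ t ∈ Ioo 0 τ, 0 ≤ A t)
    (hϑ : ∀ t ∈ Ioo t₀ τ, ϑ ≤ A t) (hY0 : 0 < Y 0) : ϑ * (τ - t₀) * Y 0 ≤ 1 := by
  have mono := monotoneOn_of_riccati hYc hY hA
  have le_Y (t : ℝ) (ht : t ∈ Icc 0 τ) : Y 0 ≤ Y t :=
    mono (left_mem_Icc.2 (ht.1.trans ht.2)) ht ht.1
  have sub : Icc t₀ τ ⊆ Icc 0 τ := Icc_subset_Icc_left ht₀.1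
  have anti := antitoneOn_inv_add_mul_of_riccati (hYc.mono sub)
    (fun t ht => hY t (Ioo_subset_Ioo_left ht₀.1 ht)) hϑ
    (fun t ht => hY0.trans_le (le_Y t (sub ht)))
    (left_mem_Icc.2 ht₀.2) (right_mem_Icc.2 ht₀.2) ht₀.2
  have inv_le : (Y t₀)⁻¹ ≤ (Y 0)⁻¹ := inv_anti₀ hY0 (le_Y t₀ ht₀)
  have inv_pos : 0 < (Y τ)⁻¹ :=
    inv_pos.2 (hY0.trans_le (le_Y τ (right_mem_Icc.2 (ht₀.1.trans ht₀.2))))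
  calc ϑ * (τ - t₀) * Y 0 ≤ (Y 0)⁻¹ * Y 0 := by gcongr; linarith
    _ = 1 := inv_mul_cancel₀ hY0.ne'

end Riccati

theorem IsNearUnitSpeed.sqrt_mem_Icc (hk : IsNearUnitSpeed k K) (θ : ℝ) :
    √(k θ) ∈ Icc (99 / 100) (101 / 100) := by
  obtain ⟨lower, upper⟩ := hk.mem_Icc θ
  exact ⟨Real.le_sqrt_of_sq_le (by linarith),
    (Real.sqrt_le_left (by norm_num)).2 (by linarith)⟩

theorem IsSlabSolution.time_le (h : IsSlabSolution k τ M v w vx wx) (hk : IsNearUnitSpeed k K)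
    (hF : ∀ θ, HasDerivAt F (k θ) θ) (hnn : ∀ t ∈ Icc 0 τ, ∀ x, 0 ≤ deriv k (v (t, x)))
    {a t₀ ϑ : ℝ} (ht₀ : t₀ ∈ Icc 0 τ) (hϑ0 : 0 < ϑ)
    (hϑ : ∀ t ∈ Icc t₀ τ, ∀ x ≤ a, w (t, x) + F (v (t, x)) = w (0, a) + F (v (0, a)) →
      ϑ ≤ deriv k (v (t, x)))
    (ha : 0 < invariantDeriv k v vx wx (0, a)) :
    ϑ * (τ - t₀) * invariantDeriv k v vx wx (0, a) ≤ 3 := by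
  have := hk.continuous
  have := h.cont_v
  have := h.continuous_invariantDeriv hk.continuous
  have hτ : 0 ≤ τ := ht₀.1.trans ht₀.2
  obtain ⟨X, hX, X0⟩ := h.exists_isCharacteristic hk (σ := 1) abs_one (left_mem_Icc.2 hτ) a
  have := hX.continuous
  have lower (t : ℝ) (ht : t ∈ Icc t₀ τ) : ϑ ≤ deriv k (v (t, X t)) := by
    have ht' : t ∈ Icc 0 τ := ⟨ht₀.1.trans ht.1, ht.2⟩
    refine hϑ t ht (X t) ?_ ?_
    · linarith [hX.le_displacement hk (one_pow 2) ht', ht'.1]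
    · simpa [X0] using h.invariant_eq hk.continuous hF (one_pow 2) hX ht'
  obtain ⟨hsqrt, -⟩ := hk.sqrt_mem_Icc (v (0, X 0))
  have riccati := riccati_time_le (ϑ := ϑ / (205 / 100)) ht₀
    (Continuous.continuousOn (by fun_prop))
    (fun t ht => h.hasDerivAt_sqrt_mul_invariantDeriv hk hX ht)
    (fun t ht => div_nonneg (hnn t (Ioo_subset_Icc_self ht) _)
      (mul_nonneg (mul_nonneg two_pos.le (hk.pos _).le) (Real.sqrt_nonneg _)))
    (fun t ht => by
      obtain ⟨k_lower, k_upper⟩ := hk.mem_Icc (v (t, X t))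
      obtain ⟨sqrt_lower, sqrt_upper⟩ := hk.sqrt_mem_Icc (v (t, X t))
      have hlow := lower t (Ioo_subset_Icc_self ht)
      exact div_le_div₀ (hϑ0.le.trans hlow) hlow (by nlinarith) (by nlinarith))
    (by rw [X0]; exact mul_pos (Real.sqrt_pos.2 (hk.pos _)) ha)
  rw [X0] at riccati hsqrt
  have time_nonneg : 0 ≤ ϑ * (τ - t₀) * invariantDeriv k v vx wx (0, a) :=
    mul_nonneg (mul_nonneg hϑ0.le (sub_nonneg.2 ht₀.2)) ha.le
  rw [show ϑ / (205 / 100) * (τ - t₀) * (√(k (v (0, a))) * invariantDeriv k v vx wx (0, a)) =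
    ϑ * (τ - t₀) * invariantDeriv k v vx wx (0, a) * (√(k (v (0, a))) / (205 / 100)) by ring]
    at riccati
  nlinarith

end Characteristics

/-! ### The upper bound -/

section UpperBound

variable {c k F V f g φ ψ : ℝ → ℝ} {U : Set ℝ} {T δ m q : ℝ} {K M : ℝ≥0}
  {u ut ux utt utx uxx : ℝ → ℝ → ℝ}

theorem exists_isNearUnitSpeed (hU : IsOpen U) (hU0 : (0 : ℝ) ∈ U) (hc : ContDiffOn ℝ 1 c U)
    (hc0 : c 0 = 1) : ∃ k K, IsNearUnitSpeed k K ∧ ∀ᶠ θ in 𝓝 0, k θ = c θ := by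
  obtain ⟨k, hk, support, hk1, hkc⟩ := exists_contDiff_eventuallyEq_near_one (n := 1) hU hU0 hc hc0
  obtain ⟨K, hK⟩ := (hk.sub contDiff_const).lipschitzWith_of_hasCompactSupport support one_ne_zero
  exact ⟨k, K, ⟨hk, fun x y => by simpa only [edist_sub_right] using hK x y, hk1⟩, hkc⟩

theorem abs_le_of_bootstrap {q : ℝ → ℝ → ℝ} {L : ℝ≥0}
    (lip : ∀ x, LipschitzOnWith L (fun t => q t x) (Ico 0 T)) (hm : m < δ) (h0 : ∀ x, |q 0 x| ≤ m)
    (improve : ∀ τ ∈ Ico 0 T, (∀ t ∈ Icc 0 τ, ∀ x, |q t x| ≤ δ) → ∀ x, |q τ x| ≤ m)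
    {t : ℝ} (ht : t ∈ Ico 0 T) (x : ℝ) : |q t x| ≤ m := by
  obtain ⟨e, he, hLe⟩ : ∃ e > 0, L * e ≤ δ - m :=
    ⟨(δ - m) / (L + 1), div_pos (sub_pos.2 hm) (by positivity), by
      rw [mul_div_left_comm]
      exact mul_le_of_le_one_right (sub_pos.2 hm).le
        ((div_le_one (by positivity)).2 (le_add_of_nonneg_right zero_le_one))⟩
  have steps (n : ℕ) : ∀ t ∈ Ico 0 T, t ≤ n * e → ∀ x, |q t x| ≤ m := by
    induction n with
    | zero =>
      intro t ht htn
      rwa [le_antisymm (by simpa using htn) ht.1]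
    | succ n ih =>
      intro t ht htn
      refine improve t ht fun r hr x => ?_
      have hr' : max 0 (r - e) ∈ Ico 0 T :=
        ⟨le_max_left _ _, max_lt (ht.1.trans_lt ht.2) (by linarith [hr.2, ht.2])⟩
      have earlier : |q (max 0 (r - e)) x| ≤ m := by
        push_cast at htn
        exact ih _ hr' (max_le (by positivity) (by linarith [hr.2])) x
      have jump := (lip x).dist_le_mul r ⟨hr.1, hr.2.trans_lt ht.2⟩ _ hr'
      have gap : |r - max 0 (r - e)| ≤ e := by
        rw [abs_of_nonneg (sub_nonneg.2 (max_le hr.1 (by linarith)))]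
        linarith [le_max_right 0 (r - e)]
      rw [Real.dist_eq, Real.dist_eq] at jump
      linarith [abs_sub_abs_le_abs_sub (q r x) (q (max 0 (r - e)) x),
        mul_le_mul_of_nonneg_left gap L.coe_nonneg]
  obtain ⟨n, hn⟩ := exists_nat_ge (t / e)
  exact steps n t ht ((div_le_iff₀ he).1 hn) x

namespace IsClassicalSolution

theorem initial_ux (h : IsClassicalSolution c U f g T u ut ux utt utx uxx) (hT : 0 < T) (x : ℝ) :
    ux 0 x = deriv f x := by
  rw [← funext h.initial_u]
  exact (h.deriv_x 0 (left_mem_Ico.2 hT) x).deriv.symm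

theorem initial_utx (h : IsClassicalSolution c U f g T u ut ux utt utx uxx) (hT : 0 < T) (x : ℝ) :
    utx 0 x = deriv g x := by
  rw [← funext h.initial_ut]
  exact (h.deriv_tx 0 (left_mem_Ico.2 hT) x).deriv.symm

theorem initial_uxx (h : IsClassicalSolution c U f g T u ut ux utt utx uxx) (hT : 0 < T) (x : ℝ) :
    uxx 0 x = deriv (deriv f) x := by
  rw [← funext (h.initial_ux hT)]
  exact (h.deriv_xx 0 (left_mem_Ico.2 hT) x).deriv.symm

theorem exists_isSlabSolution (h : IsClassicalSolution c U f g T u ut ux utt utx uxx)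
    (hxx : ∀ t ∈ Ico 0 T, ∀ x, |uxx t x| ≤ M) (htx : ∀ t ∈ Ico 0 T, ∀ x, |utx t x| ≤ M)
    {τ : ℝ} (hτ : τ ∈ Ico 0 T) (hkc : ∀ t ∈ Icc 0 τ, ∀ x, k (ux t x) = c (ux t x)) :
    ∃ v w vx wx, IsSlabSolution k τ M v w vx wx ∧ ∀ t ∈ Icc 0 τ, ∀ x,
      v (t, x) = ux t x ∧ w (t, x) = ut t x ∧ vx (t, x) = uxx t x ∧ wx (t, x) = utx t x := by
  let clamp (q : ℝ → ℝ → ℝ) (p : ℝ × ℝ) : ℝ := q (projIcc 0 τ hτ.1 p.1) p.2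
  have clamp_eq (q : ℝ → ℝ → ℝ) {t : ℝ} (ht : t ∈ Icc 0 τ) (x : ℝ) : clamp q (t, x) = q t x := by
    simp only [clamp, projIcc_of_mem hτ.1 ht]
  have mem (t : ℝ) : (projIcc 0 τ hτ.1 t : ℝ) ∈ Ico 0 T :=
    ⟨(projIcc 0 τ hτ.1 t).2.1, (projIcc 0 τ hτ.1 t).2.2.trans_lt hτ.2⟩
  have cont {q : ℝ → ℝ → ℝ} (hq : ContinuousOn (fun p : ℝ × ℝ => q p.1 p.2) (Ico 0 T ×ˢ univ)) :
      Continuous (clamp q) :=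
    hq.comp_continuous (f := fun p : ℝ × ℝ => ((projIcc 0 τ hτ.1 p.1 : ℝ), p.2)) (by fun_prop)
      fun p => ⟨mem _, mem_univ _⟩
  have inner {q : ℝ → ℝ → ℝ} {q' t x : ℝ} (ht : t ∈ Ioo 0 τ)
      (hq : HasDerivWithinAt (fun s => q s x) q' (Ico 0 T) t) :
      HasDerivAt (fun s => clamp q (s, x)) q' t := by
    refine (hq.hasDerivAt (Ico_mem_nhds ht.1 (ht.2.trans hτ.2))).congr_of_eventuallyEq ?_
    filter_upwards [Icc_mem_nhds ht.1 ht.2] with s hs using clamp_eq q hs x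
  have sub {t : ℝ} (ht : t ∈ Ioo 0 τ) : t ∈ Ico 0 T := ⟨ht.1.le, ht.2.trans hτ.2⟩
  refine ⟨clamp ux, clamp ut, clamp uxx, clamp utx, ?_, fun t ht x =>
    ⟨clamp_eq ux ht x, clamp_eq ut ht x, clamp_eq uxx ht x, clamp_eq utx ht x⟩⟩
  exact
    { cont_v := cont h.cont_ux
      cont_w := cont h.cont_ut
      cont_vx := cont h.cont_uxx
      cont_wx := cont h.cont_utx
      bound_vx := fun p => hxx _ (mem _) _
      bound_wx := fun p => htx _ (mem _) _
      deriv_v := fun t x => h.deriv_xx _ (mem t) x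
      deriv_w := fun t x => h.deriv_tx _ (mem t) x
      deriv_vt := fun t ht x => by
        rw [clamp_eq utx (Ioo_subset_Icc_self ht)]
        exact inner ht (h.deriv_xt t (sub ht) x)
      deriv_wt := fun t ht x => by
        have ht' := Ioo_subset_Icc_self ht
        rw [clamp_eq ux ht', clamp_eq uxx ht', hkc t ht' x,
          ← sub_eq_zero.1 (h.equation t (sub ht) x)]
        exact inner ht (h.deriv_tt t (sub ht) x) }

theorem abs_ux_le (h : IsClassicalSolution c U f g T u ut ux utt utx uxx)
    (hxx : ∀ t ∈ Ico 0 T, ∀ x, |uxx t x| ≤ M) (htx : ∀ t ∈ Ico 0 T, ∀ x, |utx t x| ≤ M)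
    (hk : IsNearUnitSpeed k K) (hkc : ∀ θ, |θ| ≤ δ → k θ = c θ) (hm : 6 * m < δ)
    (hf : ∀ x, |deriv f x| ≤ m) (hg : ∀ x, |g x| ≤ m) {t : ℝ} (ht : t ∈ Ico 0 T) (x : ℝ) :
    |ux t x| ≤ 6 * m := by
  have hT : 0 < T := ht.1.trans_lt ht.2
  have hm0 : 0 ≤ m := (abs_nonneg _).trans (hg 0)
  refine abs_le_of_bootstrap (L := M) (fun x => ?_) hm (fun x => ?_) (fun τ hτ small x => ?_) ht x
  · exact (convex_Ico 0 T).lipschitzOnWith_of_nnnorm_hasDerivWithin_le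
      (fun t ht => h.deriv_xt t ht x) fun t ht => htx t ht x
  · rw [h.initial_ux hT]
    linarith [hf x]
  · obtain ⟨v, w, vx, wx, slab, agree⟩ :=
      h.exists_isSlabSolution hxx htx hτ fun t ht x => hkc _ (small t ht x)
    have h0 : (0 : ℝ) ∈ Icc 0 τ := left_mem_Icc.2 hτ.1
    have hτ' : τ ∈ Icc 0 τ := right_mem_Icc.2 hτ.1
    rw [← (agree τ hτ' x).1]
    refine slab.abs_le_of_data hk (fun x => ?_) (fun x => ?_) hτ' x
    · rw [(agree 0 h0 x).1, h.initial_ux hT]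
      exact hf x
    · rw [(agree 0 h0 x).2.1, h.initial_ut]
      exact hg x

end IsClassicalSolution

theorem HasBoundedSolution.reflect (h : HasBoundedSolution c U f g T) :
    HasBoundedSolution c U (fun x => -f (-x)) (fun x => -g (-x)) T := by
  obtain ⟨u, ut, ux, utt, utx, uxx, h, M, hM⟩ := h
  have cont {q : ℝ → ℝ → ℝ} (hq : ContinuousOn (fun p : ℝ × ℝ => q p.1 p.2) (Ico 0 T ×ˢ univ)) :
      ContinuousOn (fun p : ℝ × ℝ => q p.1 (-p.2)) (Ico 0 T ×ˢ univ) :=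
    hq.comp (f := fun p : ℝ × ℝ => (p.1, -p.2)) (by fun_prop) fun p hp => ⟨hp.1, mem_univ _⟩
  have dx {q : ℝ → ℝ} {q' x : ℝ} (hq : HasDerivAt q q' (-x)) :
      HasDerivAt (fun y => q (-y)) (-q') x :=
    (hq.comp x (hasDerivAt_neg x)).congr_deriv (mul_neg_one q')
  refine ⟨fun t x => -u t (-x), fun t x => -ut t (-x), fun t x => ux t (-x),
    fun t x => -utt t (-x), fun t x => utx t (-x), fun t x => -uxx t (-x),
    { cont_u := (cont h.cont_u).neg
      cont_ut := (cont h.cont_ut).neg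
      cont_ux := cont h.cont_ux
      cont_utt := (cont h.cont_utt).neg
      cont_utx := cont h.cont_utx
      cont_uxx := (cont h.cont_uxx).neg
      deriv_t := fun t ht x => (h.deriv_t t ht (-x)).neg
      deriv_x := fun t ht x => (dx (h.deriv_x t ht (-x))).neg.congr_deriv (neg_neg _)
      deriv_tt := fun t ht x => (h.deriv_tt t ht (-x)).neg
      deriv_tx := fun t ht x => (dx (h.deriv_tx t ht (-x))).neg.congr_deriv (neg_neg _)
      deriv_xt := fun t ht x => h.deriv_xt t ht (-x)
      deriv_xx := fun t ht x => dx (h.deriv_xx t ht (-x))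
      mem_domain := fun t ht x => h.mem_domain t ht (-x)
      equation := fun t ht x => by linear_combination -h.equation t ht (-x)
      initial_u := fun x => by simp only [h.initial_u]
      initial_ut := fun x => by simp only [h.initial_ut] }, M, fun t ht x => ?_⟩
  simpa only [abs_neg] using hM t ht (-x)

theorem lifespan_le_lifespan_reflect :
    lifespan c U f g ≤ lifespan c U (fun x => -f (-x)) (fun x => -g (-x)) :=
  sSup_le_sSup fun _ ⟨T, hT, h, hτ⟩ => ⟨T, hT, h.reflect, hτ⟩

theorem MemCb.reflect {n : ℕ} (hf : MemCb n f) : MemCb n fun x => -f (-x) := by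
  refine ⟨(hf.1.comp contDiff_neg).neg, fun j hj => ?_⟩
  obtain ⟨M, hM⟩ := hf.2 j hj
  refine ⟨M, fun x => ?_⟩
  rw [iteratedDeriv_fun_neg, iteratedDeriv_comp_neg, smul_eq_mul, abs_neg, abs_mul, abs_pow,
    abs_neg, abs_one, one_pow, one_mul]
  exact hM _

theorem deriv_reflect (f : ℝ → ℝ) : deriv (fun x => -f (-x)) = fun x => deriv f (-x) := by
  funext x
  rw [deriv.fun_neg, deriv_comp_neg, neg_neg]

-- Along the characteristic issuing from `a`, the invariant `u_t - F(u_x)` eventually comes from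
-- the region `y ≤ N` where it is small, so `2 F(u_x)` stays comparable to `(u_t + F(u_x))(0, a)`.
theorem IsSlabSolution.le_abs_of_invariant_eq {v w vx wx : ℝ × ℝ → ℝ} {τ t x a N : ℝ}
    (h : IsSlabSolution k τ M v w vx wx) (hk : IsNearUnitSpeed k K) (hF : IsSpeedPrimitive k F V)
    (hN : ∀ y ≤ N, |w (0, y) - F (v (0, y))| ≤ |w (0, a) + F (v (0, a))| / 2)
    (ht : t ∈ Icc (2 * (|a| + |N|)) τ) (hx : x ≤ a)
    (hinv : w (t, x) + F (v (t, x)) = w (0, a) + F (v (0, a))) :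
    |w (0, a) + F (v (0, a))| / 8 ≤ |v (t, x)| := by
  have ht0 : 0 ≤ t := le_trans (by positivity) ht.1
  obtain ⟨y, hy, transported⟩ := h.exists_foot hk hF.hasDerivAt (σ := -1) (by simp) ⟨ht0, ht.2⟩ x
  have hyN : y ≤ N := by
    linarith [ht.1, neg_abs_le N, le_abs_self a, abs_nonneg a, abs_nonneg N]
  have difference : 2 * F (v (t, x)) =
      (w (0, a) + F (v (0, a))) - (w (0, y) - F (v (0, y))) := by linarith
  have F_lower := abs_sub_abs_le_abs_sub (w (0, a) + F (v (0, a))) (w (0, y) - F (v (0, y)))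
  rw [← difference, abs_mul, abs_two] at F_lower
  linarith [hN y hyN, hF.abs_le (v (t, x))]

theorem HasBoundedSolution.time_le (h : HasBoundedSolution c U f g T) (hk : IsNearUnitSpeed k K)
    (hF : IsSpeedPrimitive k F V) (hkc : ∀ θ, |θ| ≤ δ → k θ = c θ)
    (hnn : ∀ θ, |θ| ≤ δ → 0 ≤ deriv k θ) (hm : 6 * m < δ) (hf : ∀ x, |deriv f x| ≤ m)
    (hg : ∀ x, |g x| ≤ m) {a b N ϑ : ℝ}
    (hN : ∀ y ≤ N, |g y - F (deriv f y)| ≤ |g a + F (deriv f a)| / 2) (hϑ0 : 0 < ϑ)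
    (hϑ : ∀ θ, |θ| ≤ δ → |g a + F (deriv f a)| / 8 ≤ |θ| → ϑ ≤ deriv k θ) (hb : 0 < b)
    (ha : b ≤ deriv g a + k (deriv f a) * deriv (deriv f) a) :
    T ≤ 2 * (|a| + |N|) + 3 / (ϑ * b) := by
  obtain ⟨u, ut, ux, utt, utx, uxx, h, M, hM⟩ := h
  have hxx (t) (ht : t ∈ Ico 0 T) (x) : |uxx t x| ≤ M.toNNReal :=
    (hM t ht x).2.2.2.2.2.1.trans (Real.le_coe_toNNReal M)
  have htx (t) (ht : t ∈ Ico 0 T) (x) : |utx t x| ≤ M.toNNReal :=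
    (hM t ht x).2.2.2.2.1.trans (Real.le_coe_toNNReal M)
  set t₀ := 2 * (|a| + |N|)
  have ht₀ : 0 ≤ t₀ := by positivity
  refine le_of_forall_lt_imp_le_of_dense fun τ hτT => ?_
  rcases le_or_gt τ t₀ with hτ | hτ
  · exact hτ.trans (le_add_of_nonneg_right (by positivity))
  have hτ0 : 0 ≤ τ := ht₀.trans hτ.le
  have hT : 0 < T := hτ0.trans_lt hτT
  have small (t) (ht : t ∈ Icc 0 τ) (x) : |ux t x| ≤ δ :=
    (h.abs_ux_le hxx htx hk hkc hm hf hg ⟨ht.1, ht.2.trans_lt hτT⟩ x).trans hm.le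
  obtain ⟨v, w, vx, wx, slab, agree⟩ :=
    h.exists_isSlabSolution hxx htx ⟨hτ0, hτT⟩ fun t ht x => hkc _ (small t ht x)
  have v_small (t) (ht : t ∈ Icc 0 τ) (x) : |v (t, x)| ≤ δ := by
    rw [(agree t ht x).1]
    exact small t ht x
  have initial (x : ℝ) : v (0, x) = deriv f x ∧ w (0, x) = g x ∧ vx (0, x) = deriv (deriv f) x ∧
      wx (0, x) = deriv g x := by
    simpa only [h.initial_ux hT, h.initial_ut, h.initial_uxx hT, h.initial_utx hT]
      using agree 0 (left_mem_Icc.2 hτ0) x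
  have hb' : b ≤ invariantDeriv k v vx wx (0, a) := by
    rwa [invariantDeriv, (initial a).1, (initial a).2.2.1, (initial a).2.2.2]
  have blowup := slab.time_le hk hF.hasDerivAt (fun t ht x => hnn _ (v_small t ht x))
    ⟨ht₀, hτ.le⟩ hϑ0 (fun t ht x hx hinv => by
      refine hϑ _ (v_small t ⟨ht₀.trans ht.1, ht.2⟩ x) ?_
      have := slab.le_abs_of_invariant_eq hk hF
        (by simpa only [(initial _).1, (initial _).2.1] using hN) ht hx hinv
      simpa only [(initial _).1, (initial _).2.1] using this) (hb.trans_le hb')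
  rw [← sub_le_iff_le_add', le_div_iff₀ (mul_pos hϑ0 hb)]
  calc (τ - t₀) * (ϑ * b) = ϑ * (τ - t₀) * b := by ring
    _ ≤ ϑ * (τ - t₀) * invariantDeriv k v vx wx (0, a) :=
      mul_le_mul_of_nonneg_left hb' (mul_nonneg hϑ0.le (sub_pos.2 hτ).le)
    _ ≤ 3 := blowup

theorem eventually_half_mul_le_abs {G : ℝ → ℝ} {d : ℝ} (hG : HasDerivAt G d 0) (hG0 : G 0 = 0)
    (hd : d ≠ 0) : ∀ᶠ ε in 𝓝[>] 0, |d| / 2 * ε ≤ |G ε| := by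
  have slope : Tendsto (fun ε => |ε⁻¹ * G ε|) (𝓝[>] 0) (𝓝 |d|) := by
    simpa [hG0] using (hG.tendsto_slope_zero.mono_left
      (nhdsWithin_mono 0 fun ε hε => (mem_Ioi.1 hε).ne')).abs
  filter_upwards [slope.eventually (lt_mem_nhds (half_lt_self (abs_pos.2 hd))),
    self_mem_nhdsWithin] with ε lower (hε : 0 < ε)
  rw [abs_mul, abs_inv, abs_of_pos hε, lt_inv_mul_iff₀ hε] at lower
  linarith

theorem eventually_inv_le_exp_rpow (hq : 0 < q) :
    ∀ᶠ ε in 𝓝[>] (0 : ℝ), ε⁻¹ ≤ Real.exp (ε ^ (-q)) := by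
  have growth := (isLittleO_rpow_exp_atTop (1 / q)).bound one_pos
  filter_upwards [(tendsto_rpow_neg_nhdsGT_zero (neg_lt_zero.2 hq)).eventually growth,
    self_mem_nhdsWithin] with ε hε (hε0 : 0 < ε)
  rw [← Real.rpow_mul hε0.le, one_mul, Real.norm_eq_abs, Real.norm_eq_abs, Real.abs_exp] at hε
  simpa [hq.ne', Real.rpow_neg_one] using (le_abs_self _).trans hε

theorem eventually_exp_le_deriv {C C' : ℝ} (hC : 0 < C) (hk : ContDiff ℝ 1 k)
    (hkc : ∀ᶠ θ in 𝓝 0, k θ = c θ)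
    (hlow : ∀ᶠ θ in 𝓝[≠] (0 : ℝ), C * Real.exp (-C' * |θ| ^ (-q)) ≤ deriv c θ) :
    ∀ᶠ θ in 𝓝 (0 : ℝ), 0 ≤ deriv k θ ∧
      (θ ≠ 0 → C * Real.exp (-C' * |θ| ^ (-q)) ≤ deriv k θ) := by
  have deriv_eq : ∀ᶠ θ in 𝓝 0, deriv k θ = deriv c θ :=
    hkc.eventually_nhds.mono fun θ hθ => EventuallyEq.deriv_eq hθ
  have lower := (hlow.and (deriv_eq.filter_mono nhdsWithin_le_nhds)).mono fun θ hθ =>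
    hθ.1.trans_eq hθ.2.symm
  have nonneg_zero : 0 ≤ deriv k 0 :=
    ge_of_tendsto ((hk.continuous_deriv le_rfl).continuousAt.mono_left nhdsWithin_le_nhds)
      (lower.mono fun θ hθ => le_trans (by positivity) hθ)
  filter_upwards [eventually_nhdsWithin_iff.1 lower] with θ hθ
  refine ⟨?_, hθ⟩
  rcases eq_or_ne θ 0 with rfl | hθ0
  exacts [nonneg_zero, le_trans (by positivity) (hθ hθ0)]

theorem exists_add_ne_zero_and_deriv_pos {x₀ : ℝ} (hf : ContDiff ℝ 1 f) (hg : ContDiff ℝ 1 g)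
    (hx₀ : 0 < deriv g x₀ + deriv f x₀) : ∃ a, g a + f a ≠ 0 ∧ 0 < deriv g a + deriv f a := by
  have nonzero : ∀ᶠ x in 𝓝[≠] x₀, g x + f x ≠ 0 :=
    ((hg.differentiable one_ne_zero x₀).hasDerivAt.add
      (hf.differentiable one_ne_zero x₀).hasDerivAt).eventually_ne hx₀.ne'
  have increasing : ∀ᶠ x in 𝓝[≠] x₀, 0 < deriv g x + deriv f x :=
    eventually_nhdsWithin_of_eventually_nhds (((hg.continuous_deriv le_rfl).add
      (hf.continuous_deriv le_rfl)).continuousAt.eventually (lt_mem_nhds hx₀))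
  exact (nonzero.and increasing).exists

theorem exists_forall_le_abs_le (hφ : Tendsto (deriv φ) atBot (𝓝 0)) (hψ : Tendsto ψ atBot (𝓝 0))
    {r : ℝ} (hr : 0 < r) : ∃ N, ∀ y ≤ N, |deriv φ y| ≤ r ∧ |ψ y| ≤ r := by
  have small := Metric.closedBall_mem_nhds (0 : ℝ) hr
  simpa using eventually_atBot.1 ((hφ.eventually small).and (hψ.eventually small))

theorem eventually_abs_invariant_ge (hF : IsSpeedPrimitive k F V) (hk0 : k 0 = 1) {w v : ℝ}
    (hwv : w + v ≠ 0) : ∀ᶠ ε in 𝓝[>] (0 : ℝ), |w + v| / 2 * ε ≤ |ε * w + F (ε * v)| := by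
  have F_zero : F 0 = 0 := by simpa using hF.abs_le 0
  refine eventually_half_mul_le_abs (G := fun ε => ε * w + F (ε * v)) ?_ (by simp [F_zero]) hwv
  have hF0 : HasDerivAt F 1 (0 * v) := by simpa only [zero_mul, hk0] using hF.hasDerivAt 0
  exact ((hasDerivAt_mul_const w).add (hF0.comp 0 (hasDerivAt_mul_const v))).congr_deriv
    (by rw [one_mul])

theorem IsSpeedPrimitive.abs_mul_sub_le (hF : IsSpeedPrimitive k F V) {ε r w v : ℝ} (hε : 0 ≤ ε)
    (hv : |v| ≤ r) (hw : |w| ≤ r) : |ε * w - F (ε * v)| ≤ 3 * r * ε :=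
  calc |ε * w - F (ε * v)| ≤ |ε * w| + 2 * |ε * v| :=
        (abs_sub _ _).trans (add_le_add_right (hF.abs_le _) _)
    _ = ε * |w| + 2 * (ε * |v|) := by rw [abs_mul, abs_mul, abs_of_nonneg hε]
    _ ≤ ε * r + 2 * (ε * r) := by gcongr
    _ = 3 * r * ε := by ring

theorem eventually_invariantDeriv_ge (hk : Continuous k) (hk0 : k 0 = 1) {v vx wx : ℝ}
    (h : 0 < wx + vx) :
    ∀ᶠ ε in 𝓝[>] (0 : ℝ), (wx + vx) / 2 * ε ≤ ε * wx + k (ε * v) * (ε * vx) := by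
  have limit : Tendsto (fun ε => wx + k (ε * v) * vx) (𝓝[>] 0) (𝓝 (wx + vx)) :=
    tendsto_nhdsWithin_of_tendsto_nhds (Continuous.tendsto' (by fun_prop) _ _ (by simp [hk0]))
  filter_upwards [limit.eventually (lt_mem_nhds (half_lt_self h)), self_mem_nhdsWithin]
    with ε lower (hε : 0 < ε)
  calc (wx + vx) / 2 * ε ≤ (wx + k (ε * v) * vx) * ε := mul_le_mul_of_nonneg_right lower.le hε.le
    _ = ε * wx + k (ε * v) * (ε * vx) := by ring

theorem add_div_le_mul_exp {t₀ C κ X ε b : ℝ} (ht₀ : 0 ≤ t₀) (hC : 0 < C) (hκ : 0 ≤ κ)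
    (hX : 0 ≤ X) (hb : 0 < b) (hε : ε⁻¹ ≤ Real.exp X) :
    t₀ + 3 / (C * Real.exp (-κ * X) * (b / 2 * ε)) ≤
      (t₀ + 6 / (C * b)) * Real.exp ((κ + 1) * X) :=
  calc t₀ + 3 / (C * Real.exp (-κ * X) * (b / 2 * ε))
      = t₀ + 6 / (C * b) * (Real.exp (κ * X) * ε⁻¹) := by
        rw [neg_mul, Real.exp_neg]
        field_simp
        ring
    _ ≤ t₀ * Real.exp ((κ + 1) * X) + 6 / (C * b) * (Real.exp (κ * X) * Real.exp X) := by
        gcongr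
        exact le_mul_of_one_le_right ht₀ (Real.one_le_exp (by positivity))
    _ = (t₀ + 6 / (C * b)) * Real.exp ((κ + 1) * X) := by
        rw [← Real.exp_add, add_mul κ, one_mul, add_mul]

theorem exists_radius_of_exp_le_deriv {C C' : ℝ} (hC : 0 < C) (hC' : 0 < C') (hq : 0 < q)
    (hk : ContDiff ℝ 1 k) (hkc : ∀ᶠ θ in 𝓝 0, k θ = c θ)
    (hlow : ∀ᶠ θ in 𝓝[≠] (0 : ℝ), C * Real.exp (-C' * |θ| ^ (-q)) ≤ deriv c θ) :
    ∃ δ > 0, ∀ θ, |θ| ≤ δ → k θ = c θ ∧ 0 ≤ deriv k θ ∧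
      ∀ r > 0, r ≤ |θ| → C * Real.exp (-C' * r ^ (-q)) ≤ deriv k θ := by
  obtain ⟨δ, hδ, (hδ0 : 0 < δ)⟩ := (((eventually_forall_abs_le
    (hkc.and (eventually_exp_le_deriv hC hk hkc hlow))).filter_mono
      nhdsWithin_le_nhds).and (self_mem_nhdsWithin (s := Ioi 0))).exists
  refine ⟨δ, hδ0, fun θ hθ => ⟨(hδ θ hθ).1, (hδ θ hθ).2.1, fun r hr hrθ => ?_⟩⟩
  refine le_trans ?_ ((hδ θ hθ).2.2 (abs_pos.1 (hr.trans_le hrθ)))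
  have anti := Real.rpow_le_rpow_of_nonpos hr hrθ (neg_nonpos.2 hq.le)
  rw [neg_mul, neg_mul]
  gcongr

theorem lifespan_le_of_deriv_pos (hq : 0 < q) (hU : IsOpen U) (hU0 : (0 : ℝ) ∈ U)
    (hc : ContDiffOn ℝ 1 c U) (hc0 : c 0 = 1) (hφ : MemCb 2 φ) (hψ : MemCb 1 ψ) {C C' : ℝ}
    (hC : 0 < C) (hC' : 0 < C')
    (hlow : ∀ᶠ θ in 𝓝[≠] (0 : ℝ), C * Real.exp (-C' * |θ| ^ (-q)) ≤ deriv c θ)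
    (limφ : Tendsto (deriv φ) atBot (𝓝 0)) (limψ : Tendsto ψ atBot (𝓝 0)) {x₀ : ℝ}
    (hx₀ : 0 < deriv ψ x₀ + deriv (deriv φ) x₀) :
    ∃ C₃ > (0 : ℝ), ∃ C₄ > (0 : ℝ), ∀ᶠ ε in 𝓝[>] (0 : ℝ),
      lifespan c U (fun x => ε * φ x) (fun x => ε * ψ x) ≤
        ENNReal.ofReal (C₃ * Real.exp (C₄ * ε ^ (-q))) := by
  obtain ⟨k, K, hk, hkc⟩ := exists_isNearUnitSpeed hU hU0 hc hc0
  have hk0 : k 0 = 1 := hkc.self_of_nhds.trans hc0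
  obtain ⟨F, V, hF⟩ := exists_isSpeedPrimitive hk.continuous hk.abs_sub_one_le
  obtain ⟨δ, hδ, hδk⟩ := exists_radius_of_exp_le_deriv hC hC' hq hk.contDiff hkc hlow
  obtain ⟨M, -, -, hφM, hψM⟩ := exists_isBoundedC1_data hφ hψ
  obtain ⟨a, hσ, hb⟩ := exists_add_ne_zero_and_deriv_pos hφM.contDiff hψM.contDiff hx₀
  set b := deriv ψ a + deriv (deriv φ) a
  set σ := |ψ a + deriv φ a|
  have : 0 < σ := abs_pos.2 hσ
  obtain ⟨N, hN⟩ := exists_forall_le_abs_le limφ limψ (r := σ / 12) (by positivity)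
  have small : ∀ᶠ ε in 𝓝[>] (0 : ℝ), 6 * (ε * M) < δ := eventually_nhdsWithin_of_eventually_nhds
    ((Continuous.tendsto' (by fun_prop) 0 0 (by simp)).eventually (gt_mem_nhds hδ))
  refine ⟨2 * (|a| + |N|) + 6 / (C * b), by positivity, C' * (σ / 16) ^ (-q) + 1, by positivity, ?_⟩
  filter_upwards [self_mem_nhdsWithin, small, eventually_inv_le_exp_rpow hq,
    eventually_abs_invariant_ge hF hk0 hσ, eventually_invariantDeriv_ge hk.continuous hk0 hb]
    with ε (hε : 0 < ε) hεδ hεq invariant_ge invariantDeriv_ge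
  refine sSup_le ?_
  rintro _ ⟨T, -, sol, rfl⟩
  refine ENNReal.ofReal_le_ofReal (le_trans ?_ (add_div_le_mul_exp (by positivity) hC
    (by positivity) (by positivity) hb hεq))
  refine sol.time_le (N := N) (a := a) hk hF (fun θ hθ => (hδk θ hθ).1)
    (fun θ hθ => (hδk θ hθ).2.1) hεδ ?_ (hψM.const_mul hε.le).abs_le ?_ (by positivity) ?_
    (by positivity) ?_
  · simpa only [deriv_const_mul_field] using (hφM.const_mul hε.le).abs_le
  · intro y hy
    rw [deriv_const_mul_field, deriv_const_mul_field]
    linarith only [hF.abs_mul_sub_le hε.le (hN y hy).1 (hN y hy).2, invariant_ge]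
  · intro θ hθ hθσ
    rw [deriv_const_mul_field] at hθσ
    have := (hδk θ hθ).2.2 (σ / 16 * ε) (by positivity)
      (by linarith only [hθσ, invariant_ge])
    rwa [Real.mul_rpow (by positivity) hε.le, ← mul_assoc, neg_mul] at this
  · simpa only [deriv_const_mul_field'] using invariantDeriv_ge

theorem lifespan_le (hq : 0 < q) (hU : IsOpen U) (hU0 : (0 : ℝ) ∈ U)
    (hc : ContDiffOn ℝ 1 c U) (hc0 : c 0 = 1) (hφ : MemCb 2 φ) (hψ : MemCb 1 ψ) {C C' : ℝ}
    (hC : 0 < C) (hC' : 0 < C')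
    (hlow : ∀ᶠ θ in 𝓝[≠] (0 : ℝ), C * Real.exp (-C' * |θ| ^ (-q)) ≤ deriv c θ)
    (limφ : Tendsto (deriv φ) (cocompact ℝ) (𝓝 0)) (limψ : Tendsto ψ (cocompact ℝ) (𝓝 0)) {x₀ : ℝ}
    (hx₀ : 0 < deriv ψ x₀ + deriv (deriv φ) x₀ ∨ 0 < deriv ψ x₀ - deriv (deriv φ) x₀) :
    ∃ C₃ > (0 : ℝ), ∃ C₄ > (0 : ℝ), ∀ᶠ ε in 𝓝[>] (0 : ℝ),
      lifespan c U (fun x => ε * φ x) (fun x => ε * ψ x) ≤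
        ENNReal.ofReal (C₃ * Real.exp (C₄ * ε ^ (-q))) := by
  rcases hx₀ with hx₀ | hx₀
  · exact lifespan_le_of_deriv_pos hq hU hU0 hc hc0 hφ hψ hC hC' hlow
      (limφ.mono_left atBot_le_cocompact) (limψ.mono_left atBot_le_cocompact) hx₀
  · have neg_lim : Tendsto (fun x : ℝ => -x) atBot (cocompact ℝ) :=
      tendsto_neg_atBot_atTop.mono_right atTop_le_cocompact
    obtain ⟨C₃, hC₃, C₄, hC₄, h⟩ := lifespan_le_of_deriv_pos hq hU hU0 hc hc0 hφ.reflect hψ.reflect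
      hC hC' hlow (by rw [deriv_reflect]; exact limφ.comp neg_lim)
      (by simpa using (limψ.comp neg_lim).neg) (x₀ := -x₀) (by
        rw [deriv_reflect, deriv_reflect, deriv_comp_neg]
        simpa [sub_eq_add_neg] using hx₀)
    refine ⟨C₃, hC₃, C₄, hC₄, h.mono fun ε hε => lifespan_le_lifespan_reflect.trans ?_⟩
    simpa only [mul_neg] using hε

end UpperBound

theorem theorem7 (s : ℝ) (hs : 1 < s) (U : Set ℝ) (hU : IsOpen U) (hU0 : (0 : ℝ) ∈ U)
    (c : ℝ → ℝ) (hc : MemGevrey s U c) (hc0 : c 0 = 1)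
    (hflat : ∀ m : ℕ, 1 ≤ m → iteratedDeriv m c 0 = 0)
    (φ ψ : ℝ → ℝ) (hφ : MemCb 2 φ) (hψ : MemCb 1 ψ) :
    (∃ ε₀ > (0 : ℝ), ∃ C₁ > (0 : ℝ), ∃ C₂ > (0 : ℝ), ∀ ε : ℝ, 0 < ε → ε ≤ ε₀ →
      ENNReal.ofReal (C₁ * Real.exp (C₂ * ε ^ (-(1 / (s - 1))))) ≤
        lifespan c U (fun x => ε * φ x) (fun x => ε * ψ x)) ∧
    ((∃ C > (0 : ℝ), ∃ C' > (0 : ℝ), ∀ᶠ θ in 𝓝[≠] (0 : ℝ),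
        C * Real.exp (-C' * |θ| ^ (-(1 / (s - 1)))) ≤ deriv c θ) →
      Tendsto (deriv φ) (cocompact ℝ) (𝓝 0) →
      Tendsto ψ (cocompact ℝ) (𝓝 0) →
      (∃ x₀ : ℝ, 0 < deriv ψ x₀ + deriv (deriv φ) x₀ ∨ 0 < deriv ψ x₀ - deriv (deriv φ) x₀) →
      ∃ ε₀ > (0 : ℝ), ∃ C₃ > (0 : ℝ), ∃ C₄ > (0 : ℝ), ∀ ε : ℝ, 0 < ε → ε ≤ ε₀ →
        lifespan c U (fun x => ε * φ x) (fun x => ε * ψ x) ≤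
          ENNReal.ofReal (C₃ * Real.exp (C₄ * ε ^ (-(1 / (s - 1)))))) := by
  have hq : 0 < 1 / (s - 1) := one_div_pos.2 (sub_pos.2 hs)
  have hc1 : ContDiffOn ℝ 1 c U := hc.1.of_le (by exact_mod_cast le_top)
  refine ⟨?_, ?_⟩
  · obtain ⟨C₁, hC₁, C₂, hC₂, h⟩ := le_lifespan hs hU hU0 hc hc0 hflat hφ hψ
    obtain ⟨ε₀, hε₀, h⟩ := mem_nhdsGT_iff_exists_Ioc_subset.1 h
    exact ⟨ε₀, hε₀, C₁, hC₁, C₂, hC₂, fun ε hε hle => h ⟨hε, hle⟩⟩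
  · rintro ⟨C, hC, C', hC', hlow⟩ limφ limψ ⟨x₀, hx₀⟩
    obtain ⟨C₃, hC₃, C₄, hC₄, h⟩ :=
      lifespan_le hq hU hU0 hc1 hc0 hφ hψ hC hC' hlow limφ limψ hx₀
    obtain ⟨ε₀, hε₀, h⟩ := mem_nhdsGT_iff_exists_Ioc_subset.1 h
    exact ⟨ε₀, hε₀, C₃, hC₃, C₄, hC₄, fun ε hε hle => h ⟨hε, hle⟩⟩
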